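/- Let $K$ be a commutative ring. An $A_\infty$-category $\mathcal C$ over $K$ consists of a set of objects, $\mathbb Z$-graded $K$-modules $\mathrm{Hom}_{\mathcal C}(x,y)$ and $K$-linear maps $m^d:\mathrm{Hom}(x_{d-1},x_d)\otimes\cdots\otimes\mathrm{Hom}(x_0,x_1)\to\mathrm{Hom}(x_0,x_d)$ of degree $2-d$ ($d\ge1$) with $$\sum_{1\le m\le d,\ 0\le n\le d-m}(-1)^{\dagger_n}\,m^{d-m+1}(a_d,\dots,a_{n+m+1},m^m(a_{n+m},\dots,a_{n+1}),a_n,\dots,a_1)=0,\qquad \dagger_n=\sum_{i\le n}\deg a_i-n .$$ It is unital if every object $x$ has $1_x\in\mathrm{Hom}^0(x,x)$ with $m^2(f,1_x)=f$, $m^2(1_x,g)=(-1)^{\deg g}g$ and $m^n(\dots,1_x,\dots)=0$ for $n>2$. A unital $A_\infty$-functor $F:\mathcal A\to\mathcal B$ is a map $F_0$ on objects together with $K$-linear maps $F_n$ ($n\ge1$) of degree $1-n$ on composable $n$-tuples, such that $$\sum_{r\ge 1}\ \sum_{s_1+\dots+s_r=d}m^r_{\mathcal B}\big(F_{s_r}(a_d,\dots),\dots,F_{s_1}(a_{s_1},\dots,a_1)\big)=\sum_{m,n}(-1)^{\dagger_n}F_{d-m+1}\big(a_d,\dots,m^m_{\mathcal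 A}(a_{n+m},\dots,a_{n+1}),\dots,a_1\big),$$ with $F_1(1_x)=1_{F_0x}$ and $F_n(\dots,1_x,\dots)=0$ for $n\ge2$. Let $[n]_K$ be the $K$-linear category with objects $0,\dots,n$, with $\mathrm{Hom}(i,k)=K\cdot j_{ik}$ for $i\le k$ and $0$ for $i>k$, and with $j_{kl}j_{ik}=j_{il}$, $j_{ii}=1$, regarded as a unital $A_\infty$-category concentrated in degree $0$. The $A_\infty$-nerve $N_{A_\infty}(\mathcal C)$ is the simplicial set whose $n$-simplices are the unital $A_\infty$-functors $[n]_K\to\mathcal C$; a monotone map $\alpha:[m]\to[n]$ acts by precomposition with $j_{ik}\mapsto j_{\alpha(i)\alpha(k)}$. For a simplicial set $X$ and $x,y\in X_0$, let $\mathrm{Hom}^R_X(x,y)$ be the simplicial set whose $n$-simplices are the $(n+1)$-simplices of $X$ whose restriction to $\{n+1\}$ is $y$ and whose restriction to $\{0,\dots,n\}$ is the degenerate $n$-simplex on $x$; here $\alpha:[m]\to[n]$ acts through its extension $[m+1]\to[n+1]$ with $m+1\mapsto n+1$. Let $\mathrm{Map}_{\mathcal C}(x,y)$ be the cochain complex $(\mathrm{Hom}^\bullet_{\mathcal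 C}(x,y),m^1)$, and let $\tau_{\ge0}\mathrm{Map}_{\mathcal C}(x,y)$ be the chain complex given by $\mathrm{Hom}^{-n}_{\mathcal C}(x,y)$ in degree $n>0$ and by $\ker(m^1:\mathrm{Hom}^0\to\mathrm{Hom}^1)$ in degree $0$. Let $\mathrm{DK}$ denote the Dold–Kan functor from nonnegatively graded chain complexes of $K$-modules to simplicial $K$-modules. **Lemma.** Let $\mathcal C$ be a unital $A_\infty$-category over $K$ and let $x,y$ be objects of $\mathcal C$. Then there is an isomorphism of simplicial sets (in particular an equivalence) $$\mathrm{Hom}^R_{N_{A_\infty}(\mathcal C)}(x,y)\;\cong\;\mathrm{DK}\big(\tau_{\ge0}\mathrm{Map}_{\mathcal C}(x,y)\big),$$ and it is $K$-linear in the following sense: for $n$-simplices $\sigma,\tau$ of the left hand side and $c\in K$ there is an $n$-simplex $\rho$ whose components on all composable tuples in $[n+1]_K$ from an object of $\{0,\dots,n\}$ to $n+1$ are those of $\sigma$ plus $c$ times those of $\tau$, and the image of $\rho$ is the image of $\sigma$ plus $c$ times the image of $\tau$. -/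

import Mathlib

open CategoryTheory Opposite

universe u v w

set_option linter.checkUnivs false

noncomputable section

/-! ## Composable chains -/

/-- `Chain H x y`: finite composable sequences `x = x₀ → x₁ → ⋯ → x_d = y` of elements
`a_i : H x_{i-1} x_i`. The last element `a_d` is the one added by `snoc`; in the usual notation the
chain `((nil x₀).snoc a₁).snoc a₂ ⋯` is the tuple `(a_d, …, a₁)`. -/
inductive Chain {O : Type w} (H : O → O → Type v) : O → O → Type (max w v)
  | nil (x : O) : Chain H x x
  | snoc {x y z : O} (p : Chain H x y) (a : H y z) : Chain H x z

namespace Chain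

variable {O : Type*} {H : O → O → Type*}

/-- The number of elements of a chain. -/
def length {x : O} : {y : O} → Chain H x y → ℕ
  | _, nil _ => 0
  | _, snoc p _ => p.length + 1

/-- Concatenation: first `p`, then `q`. -/
def append {x y : O} (p : Chain H x y) : {z : O} → Chain H y z → Chain H x z
  | _, nil _ => p
  | _, snoc q a => snoc (p.append q) a

/-- Apply a map of objects and maps on the `H x y` to all elements of a chain. -/
def map {O' : Type*} {H' : O' → O' → Type*} (o : O → O') (f : ∀ {x y : O}, H x y → H' (o x) (o y))
    {x : O} : {y : O} → Chain H x y → Chain H' (o x) (o y)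
  | _, nil _ => nil (o x)
  | _, snoc p a => snoc (map o f p) (f a)

/-- All ways of writing a chain as a concatenation of two chains (either may be empty). -/
def splits {x : O} : {z : O} → Chain H x z → List (Σ y : O, Chain H x y × Chain H y z)
  | _, nil _ => [⟨x, nil x, nil x⟩]
  | z, snoc p a =>
      ⟨z, snoc p a, nil z⟩ :: (splits p).map fun s => ⟨s.1, s.2.1, snoc s.2.2 a⟩

section blocks

variable {O' : Type*} {H' : O' → O' → Type*} {o : O → O'}

/-- Auxiliary to `blocks`: `s` is the last block, still growing to the left; the elements of `p`
are either added to it or distributed over further blocks. -/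
def blocksAux (φ : ∀ {x y : O}, Chain H x y → H' (o x) (o y)) {x : O} :
    {y z : O} → Chain H x y → Chain H y z → List (Chain H' (o x) (o z))
  | _, _, nil _, s => [snoc (nil (o x)) (φ s)]
  | _, _, snoc p a, s =>
      (blocksAux φ p (snoc (nil _) a)).map (fun c => snoc c (φ s)) ++
        blocksAux φ p ((snoc (nil _) a).append s)

/-- For a chain `p = (a_d, …, a₁)`: the list of all chains `(φ(p_r), …, φ(p₁))`, where
`p = p₁ ⋯ p_r` runs through the decompositions of `p` into consecutive nonempty blocks. -/
def blocks (φ : ∀ {x y : O}, Chain H x y → H' (o x) (o y)) {x : O} :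
    {y : O} → Chain H x y → List (Chain H' (o x) (o y))
  | _, nil _ => [nil (o x)]
  | _, snoc p a => blocksAux φ p (snoc (nil _) a)

end blocks

end Chain

/-! ## `A_∞`-categories -/

/-- Objects together with, for any two objects, a graded `K`-module `Hom x y = ⨁ₖ Homᵏ(x, y)`. -/
structure GradedQuiver (K : Type u) [CommRing K] where
  Obj : Type w
  Hom : Obj → Obj → Type v
  [addCommGroup : ∀ x y, AddCommGroup (Hom x y)]
  [module : ∀ x y, Module K (Hom x y)]
  deg : ∀ x y, ℤ → Submodule K (Hom x y)
  isInternal : ∀ x y, DirectSum.IsInternal (deg x y)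

attribute [instance] GradedQuiver.addCommGroup GradedQuiver.module

namespace GradedQuiver

variable {K : Type u} [CommRing K] (G : GradedQuiver.{u, v, w} K)

/-- A homogeneous element of `Hom x y` together with its degree. -/
abbrev HomogHom (x y : G.Obj) : Type v := Σ k : ℤ, G.deg x y k

variable {G}

/-- The chain of elements underlying a chain of homogeneous elements. -/
def under {x y : G.Obj} (p : Chain G.HomogHom x y) : Chain G.Hom x y :=
  p.map (fun x => x) (fun a => (a.2 : G.Hom _ _))

/-- `(deg a₁ - 1) + ⋯ + (deg a_d - 1) = deg a₁ + ⋯ + deg a_d - d`. -/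
def sdeg {x : G.Obj} : {y : G.Obj} → Chain G.HomogHom x y → ℤ
  | _, .nil _ => 0
  | _, .snoc p a => sdeg p + (a.1 - 1)

/-- A function on chains that is `K`-linear in each element of the chain, i.e. a family of
`K`-linear maps `Hom(x_{d-1}, x_d) ⊗ ⋯ ⊗ Hom(x₀, x₁) → N(x₀, x_d)`. -/
structure IsMultilinear (G : GradedQuiver.{u, v, w} K) {N : G.Obj → G.Obj → Type*}
    [∀ x y, AddCommGroup (N x y)] [∀ x y, Module K (N x y)]
    (φ : ∀ {x y : G.Obj}, Chain G.Hom x y → N x y) : Prop where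
  map_add : ∀ {x y z t : G.Obj} (p : Chain G.Hom x y) (a b : G.Hom y z) (q : Chain G.Hom z t),
    φ ((p.snoc (a + b)).append q) = φ ((p.snoc a).append q) + φ ((p.snoc b).append q)
  map_smul : ∀ {x y z t : G.Obj} (p : Chain G.Hom x y) (c : K) (a : G.Hom y z)
    (q : Chain G.Hom z t), φ ((p.snoc (c • a)).append q) = c • φ ((p.snoc a).append q)

/-- For `p = (a_d, …, a₁)` homogeneous, the sum over all consecutive subchains of
`(-1)^{†} φ(a_d, …, a_{n+m+1}, μ(a_{n+m}, …, a_{n+1}), a_n, …, a₁)`, where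
`† = deg a₁ + ⋯ + deg a_n - n`. (The subchain may be empty here; these terms vanish in the
applications below, where `μ` is zero on empty chains and `φ` is multilinear.) -/
def barSum {N : G.Obj → G.Obj → Type*} [∀ x y, AddCommGroup (N x y)]
    (μ : ∀ {x y : G.Obj}, Chain G.Hom x y → G.Hom x y)
    (φ : ∀ {x y : G.Obj}, Chain G.Hom x y → N x y)
    {x y : G.Obj} (p : Chain G.HomogHom x y) : N x y :=
  (p.splits.map fun s => (sdeg s.2.1).negOnePow •
    (s.2.2.splits.map fun t =>
      φ (((under s.2.1).snoc (μ (under t.2.1))).append (under t.2.2))).sum).sum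

end GradedQuiver

open GradedQuiver

/-- An `A_∞`-category over `K`. The operation `m` on chains of length `d` is `m^d`; the value on
empty chains is normalized to be zero (there is no `m^0`). -/
structure AInfCat (K : Type u) [CommRing K] extends GradedQuiver.{u, v, w} K where
  m : ∀ {x y : Obj}, Chain Hom x y → Hom x y
  m_nil : ∀ x : Obj, m (Chain.nil x) = 0
  m_multilinear : IsMultilinear toGradedQuiver (N := Hom) m
  /-- `m^d` has degree `2 - d`. -/
  m_deg : ∀ {x y : Obj} (p : Chain toGradedQuiver.HomogHom x y),
    m (under p) ∈ deg x y (sdeg p + 2)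
  /-- The `A_∞`-relations. -/
  m_rel : ∀ {x y : Obj} (p : Chain toGradedQuiver.HomogHom x y), barSum (N := Hom) m m p = 0

/-- A (strictly) unital `A_∞`-category over `K`. -/
structure UnitalAInfCat (K : Type u) [CommRing K] extends AInfCat.{u, v, w} K where
  one : ∀ x : Obj, Hom x x
  one_mem : ∀ x, one x ∈ deg x x 0
  /-- `m²(f, 1_x) = f`. -/
  m_one_right : ∀ {x y : Obj} (f : Hom x y), m (((Chain.nil x).snoc (one x)).snoc f) = f
  /-- `m²(1_y, g) = (-1)^{deg g} g`. -/
  m_one_left : ∀ {x y : Obj} (k : ℤ) (g : Hom x y), g ∈ deg x y k →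
    m (((Chain.nil x).snoc g).snoc (one y)) = k.negOnePow • g
  /-- `mⁿ(…, 1_y, …) = 0` for `n > 2`. -/
  m_one : ∀ {x y z : Obj} (p : Chain Hom x y) (q : Chain Hom y z), 2 < p.length + 1 + q.length →
    m ((p.snoc (one y)).append q) = 0

/-- A unital `A_∞`-functor `F : A → B`. The value of `map` on chains of length `n` is `F_n`, which
has degree `1 - n`; on empty chains it is normalized to be zero. -/
structure AInfFunctor {K : Type u} [CommRing K] (A B : UnitalAInfCat K) where
  obj : A.Obj → B.Obj
  map : ∀ {x y : A.Obj}, Chain A.Hom x y → B.Hom (obj x) (obj y)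
  map_nil : ∀ x : A.Obj, map (Chain.nil x) = 0
  map_multilinear :
    IsMultilinear A.toGradedQuiver (N := fun x y => B.Hom (obj x) (obj y)) map
  map_deg : ∀ {x y : A.Obj} (p : Chain A.HomogHom x y),
    map (under p) ∈ B.deg (obj x) (obj y) (sdeg p + 1)
  /-- `∑ m_B^r(F_{s_r}(a_d, …), …, F_{s_1}(…, a₁))
      = ∑ (-1)^† F_{d-m+1}(a_d, …, m_A^m(a_{n+m}, …, a_{n+1}), …, a₁)`. -/
  map_rel : ∀ {x y : A.Obj} (p : Chain A.HomogHom x y),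
    ((Chain.blocks (o := obj) map (under p)).map fun c => B.m c).sum =
      barSum (N := fun x y => B.Hom (obj x) (obj y)) A.m map p
  map_one : ∀ x : A.Obj, map ((Chain.nil x).snoc (A.one x)) = B.one (obj x)
  map_one_eq_zero : ∀ {x y z : A.Obj} (p : Chain A.Hom x y) (q : Chain A.Hom y z),
    2 ≤ p.length + 1 + q.length → map ((p.snoc (A.one y)).append q) = 0

/-- A strict unital `A_∞`-functor: one with `F_n = 0` for `n ≥ 2`, given by its linear part. -/
structure StrictFunctor {K : Type u} [CommRing K] (A B : UnitalAInfCat K) where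
  obj : A.Obj → B.Obj
  lin : ∀ {x y : A.Obj}, A.Hom x y →ₗ[K] B.Hom (obj x) (obj y)
  lin_deg : ∀ {x y : A.Obj} (k : ℤ) (a : A.Hom x y), a ∈ A.deg x y k →
    lin a ∈ B.deg (obj x) (obj y) k
  lin_m : ∀ {x y : A.Obj} (p : Chain A.Hom x y),
    lin (A.m p) = B.m (p.map (H' := B.Hom) obj (fun a => lin a))
  lin_one : ∀ x : A.Obj, lin (A.one x) = B.one (obj x)

/-! ### Helper facts on chains -/

namespace Chain

variable {O : Type*} {H : O → O → Type*}

lemma length_append {x y z : O} (p : Chain H x y) (q : Chain H y z) :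
    (p.append q).length = p.length + q.length := by
  induction q with
  | nil => rfl
  | snoc q a ih => simp only [append, length, ih]; omega

lemma nil_append {x y : O} (p : Chain H x y) : (nil x).append p = p := by
  induction p with
  | nil => rfl
  | snoc p a ih => simp only [append, ih]

lemma append_assoc {x y z t : O} (p : Chain H x y) (q : Chain H y z) (r : Chain H z t) :
    (p.append q).append r = p.append (q.append r) := by
  induction r with
  | nil => rfl
  | snoc r a ih => simp only [append, ih]

lemma append_of_splits {x z : O} (p : Chain H x z) :
    ∀ s ∈ p.splits, s.2.1.append s.2.2 = p := by
  induction p with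
  | nil => intro s hs; simp only [splits, List.mem_singleton] at hs; subst hs; rfl
  | snoc p a ih =>
    intro s hs
    simp only [splits, List.mem_cons, List.mem_map] at hs
    rcases hs with rfl | ⟨t, ht, rfl⟩
    · rfl
    · simp only [append, ih t ht]

section map

variable {O' : Type*} {H' : O' → O' → Type*} {O'' : Type*} {H'' : O'' → O'' → Type*}
variable (o : O → O') (f : ∀ {x y : O}, H x y → H' (o x) (o y))

@[simp] lemma length_map {x y : O} (p : Chain H x y) :
    (p.map (H' := H') o f).length = p.length := by
  induction p with
  | nil => rfl
  | snoc p a ih => simp only [map, length, ih]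

lemma map_append {x y z : O} (p : Chain H x y) (q : Chain H y z) :
    (p.append q).map (H' := H') o f = (p.map (H' := H') o f).append (q.map (H' := H') o f) := by
  induction q with
  | nil => rfl
  | snoc q a ih => simp only [append, map, ih]

lemma map_map (o' : O' → O'') (f' : ∀ {x y : O'}, H' x y → H'' (o' x) (o' y))
    {x y : O} (p : Chain H x y) :
    (p.map (H' := H') o f).map (H' := H'') o' f' =
      p.map (H' := H'') (fun x => o' (o x)) (fun a => f' (f a)) := by
  induction p with
  | nil => rfl
  | snoc p a ih => simp only [map, ih]

lemma map_id {x y : O} (p : Chain H x y) : p.map (H' := H) (fun x => x) (fun a => a) = p := by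
  induction p with
  | nil => rfl
  | snoc p a ih => simp only [map, ih]

lemma splits_map {x y : O} (p : Chain H x y) :
    (p.map (H' := H') o f).splits =
      p.splits.map (fun s => ⟨o s.1, s.2.1.map (H' := H') o f, s.2.2.map (H' := H') o f⟩) := by
  induction p with
  | nil => rfl
  | snoc p a ih => simp [map, splits, ih, Function.comp_def]

lemma blocksAux_map {o' : O' → O''} (φ : ∀ {x y : O'}, Chain H' x y → H'' (o' x) (o' y))
    {x y z : O} (p : Chain H x y) (s : Chain H y z) :
    blocksAux (o := o') φ (p.map (H' := H') o f) (s.map (H' := H') o f) =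
      blocksAux (H' := H'') (o := fun x => o' (o x)) (fun c => φ (c.map (H' := H') o f)) p s := by
  induction p generalizing z with
  | nil => rfl
  | snoc p a ih =>
    simp only [map, blocksAux]
    rw [← ih, ← ih, map_append]
    rfl

lemma blocks_map {o' : O' → O''} (φ : ∀ {x y : O'}, Chain H' x y → H'' (o' x) (o' y))
    {x y : O} (p : Chain H x y) :
    blocks (o := o') φ (p.map (H' := H') o f) =
      blocks (H' := H'') (o := fun x => o' (o x)) (fun c => φ (c.map (H' := H') o f)) p := by
  cases p with
  | nil => rfl
  | snoc p a => exact blocksAux_map o f φ p ((nil _).snoc a)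

end map

end Chain

lemma Chain.sum_splits_eq_left {O : Type*} {H : O → O → Type*} {M : Type*} [AddCommMonoid M]
    {x z : O} (p : Chain H x z) (g : (Σ y : O, Chain H x y × Chain H y z) → M)
    (hg : ∀ s ∈ p.splits, 1 ≤ s.2.1.length → g s = 0) :
    (p.splits.map g).sum = g ⟨x, .nil x, p⟩ := by
  induction p with
  | nil => simp [splits]
  | snoc p a ih =>
    have h := ih (fun s => g ⟨s.1, s.2.1, s.2.2.snoc a⟩) (fun s hs h1 =>
      hg _ (by simp only [splits, List.mem_cons, List.mem_map]; exact Or.inr ⟨s, hs, rfl⟩) h1)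
    have h0 := hg _ (by simp only [splits]; exact List.mem_cons_self)
      (by simp only [length]; omega)
    simp only [splits, List.map_cons, List.sum_cons, List.map_map, Function.comp_def]
    rw [h0, zero_add]
    exact h

lemma Chain.sum_splits_eq_right {O : Type*} {H : O → O → Type*} {M : Type*} [AddCommMonoid M]
    {x z : O} (p : Chain H x z) (g : (Σ y : O, Chain H x y × Chain H y z) → M)
    (hg : ∀ s ∈ p.splits, 1 ≤ s.2.2.length → g s = 0) :
    (p.splits.map g).sum = g ⟨z, p, .nil z⟩ := by
  cases p with
  | nil => simp [splits]
  | snoc p a =>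
    simp only [splits, List.map_cons, List.sum_cons, List.map_map, Function.comp_def]
    rw [List.sum_eq_zero, add_zero]
    intro b hb
    simp only [List.mem_map] at hb
    obtain ⟨s, hs, rfl⟩ := hb
    exact hg _ (by simp only [splits, List.mem_cons, List.mem_map]; exact Or.inr ⟨s, hs, rfl⟩)
      (by simp only [length]; omega)

namespace GradedQuiver

variable {K : Type u} [CommRing K] {G : GradedQuiver.{u, v, w} K}

lemma length_under {x y : G.Obj} (p : Chain G.HomogHom x y) : (under p).length = p.length :=
  Chain.length_map _ _ p

lemma IsMultilinear.map_zero {N : G.Obj → G.Obj → Type*}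
    [∀ x y, AddCommGroup (N x y)] [∀ x y, Module K (N x y)]
    {φ : ∀ {x y : G.Obj}, Chain G.Hom x y → N x y} (h : IsMultilinear G (N := N) φ)
    {x y z t : G.Obj} (p : Chain G.Hom x y) (q : Chain G.Hom z t) :
    φ ((p.snoc (0 : G.Hom y z)).append q) = 0 := by
  have := h.map_smul p 0 (0 : G.Hom y z) q
  simpa using this

end GradedQuiver

/-! ### Strict functors -/

namespace StrictFunctor

variable {K : Type u} [CommRing K]

/-- The identity functor. -/
def id (A : UnitalAInfCat K) : StrictFunctor A A where
  obj x := x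
  lin := LinearMap.id
  lin_deg _ _ h := h
  lin_m p := by
    simp only [LinearMap.id_apply]
    rw [Chain.map_id]
  lin_one _ := rfl

/-- Composition: first `F`, then `G`. -/
def comp {A B C : UnitalAInfCat K} (F : StrictFunctor A B) (G : StrictFunctor B C) :
    StrictFunctor A C where
  obj x := G.obj (F.obj x)
  lin := G.lin ∘ₗ F.lin
  lin_deg k a h := G.lin_deg k _ (F.lin_deg k a h)
  lin_m p := by
    simp only [LinearMap.comp_apply, F.lin_m, G.lin_m]
    rw [Chain.map_map]
  lin_one x := by simp only [LinearMap.comp_apply, F.lin_one, G.lin_one]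

section

variable {A B : UnitalAInfCat K} (G : StrictFunctor A B)

/-- A strict functor on chains. -/
def mapChain {x y : A.Obj} (p : Chain A.Hom x y) : Chain B.Hom (G.obj x) (G.obj y) :=
  p.map G.obj (fun a => G.lin a)

/-- A strict functor on chains of homogeneous elements. -/
def mapHomog {x y : A.Obj} (p : Chain A.HomogHom x y) : Chain B.HomogHom (G.obj x) (G.obj y) :=
  p.map (H' := B.HomogHom) G.obj (fun a => ⟨a.1, ⟨G.lin a.2.1, G.lin_deg _ _ a.2.2⟩⟩)

lemma under_mapHomog {x y : A.Obj} (p : Chain A.HomogHom x y) :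
    under (G.mapHomog p) = G.mapChain (under p) := by
  simp only [under, mapHomog, mapChain, Chain.map_map]

lemma sdeg_mapHomog {x y : A.Obj} (p : Chain A.HomogHom x y) :
    sdeg (G.mapHomog p) = sdeg p := by
  induction p with
  | nil => rfl
  | snoc p a ih => exact congrArg (· + (a.1 - 1)) ih

lemma mapChain_append {x y z : A.Obj} (p : Chain A.Hom x y) (q : Chain A.Hom y z) :
    G.mapChain (p.append q) = (G.mapChain p).append (G.mapChain q) := Chain.map_append _ _ p q

lemma mapChain_snoc {x y z : A.Obj} (p : Chain A.Hom x y) (a : A.Hom y z) :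
    G.mapChain (p.snoc a) = (G.mapChain p).snoc (G.lin a) := rfl

lemma length_mapChain {x y : A.Obj} (p : Chain A.Hom x y) :
    (G.mapChain p).length = p.length := Chain.length_map _ _ p

/-- The components of a strict functor, seen as an `A_∞`-functor. -/
def onChain {x : A.Obj} : {y : A.Obj} → Chain A.Hom x y → B.Hom (G.obj x) (G.obj y)
  | _, .nil _ => 0
  | _, .snoc (.nil _) a => G.lin a
  | _, .snoc (.snoc _ _) _ => 0

lemma onChain_eq_zero {x y : A.Obj} (p : Chain A.Hom x y) (h : p.length ≠ 1) :
    G.onChain p = 0 := by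
  match p with
  | .nil _ => rfl
  | .snoc (.nil _) a => simp [Chain.length] at h
  | .snoc (.snoc _ _) _ => rfl

lemma sum_blocksAux {x y z : A.Obj} (p : Chain A.Hom x y) (s : Chain A.Hom y z)
    (hs : 1 ≤ s.length) {t : B.Obj} (c : Chain B.Hom (G.obj z) t) :
    ((Chain.blocksAux (H' := B.Hom) (o := G.obj) G.onChain p s).map
      fun b => B.m (b.append c)).sum =
      B.m (((G.mapChain p).snoc (G.onChain s)).append c) := by
  induction p generalizing z t with
  | nil => simp [Chain.blocksAux, mapChain, Chain.map]
  | snoc p a ih =>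
    have h1 := ih ((Chain.nil _).snoc a) (by simp [Chain.length])
      (((Chain.nil _).snoc (G.onChain s)).append c)
    have h2 := ih (((Chain.nil _).snoc a).append s)
      (by rw [Chain.length_append]; omega) c
    have h3 : G.onChain (((Chain.nil _).snoc a).append s) = 0 :=
      G.onChain_eq_zero _ (by rw [Chain.length_append]; simp only [Chain.length]; omega)
    rw [h3, B.m_multilinear.map_zero] at h2
    simp only [Chain.blocksAux, List.map_append, List.sum_append, List.map_map, Function.comp_def,
      h2, add_zero]
    simp only [← Chain.append_assoc] at h1
    exact h1

/-- A strict functor as an `A_∞`-functor. -/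
def toAInfFunctor : AInfFunctor A B where
  obj := G.obj
  map := G.onChain
  map_nil _ := rfl
  map_multilinear :=
    { map_add := fun p a b q => by
        cases p <;> cases q <;>
          first
            | exact G.lin.map_add a b
            | (rw [G.onChain_eq_zero, G.onChain_eq_zero, G.onChain_eq_zero, add_zero] <;>
                simp only [Chain.length_append, Chain.length] <;> omega)
      map_smul := fun p k a q => by
        cases p <;> cases q <;>
          first
            | exact G.lin.map_smul k a
            | (rw [G.onChain_eq_zero, G.onChain_eq_zero, smul_zero] <;>
                simp only [Chain.length_append, Chain.length] <;> omega) }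
  map_deg p := by
    match p with
    | .nil _ => exact Submodule.zero_mem _
    | .snoc (.nil _) a =>
      have := G.lin_deg _ _ a.2.2
      simpa [under, Chain.map, onChain, sdeg] using this
    | .snoc (.snoc _ _) _ => exact Submodule.zero_mem _
  map_rel {x y} p := by
    have hR : barSum (N := fun x y => B.Hom (G.obj x) (G.obj y)) A.m G.onChain p =
        G.lin (A.m (under p)) := by
      unfold barSum
      rw [Chain.sum_splits_eq_left]
      · rw [Chain.sum_splits_eq_right]
        · simp [sdeg, under, Chain.map, Chain.append, onChain]
        · intro t _ ht
          refine G.onChain_eq_zero _ ?_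
          simp only [Chain.length_append, Chain.length, length_under]
          omega
      · intro s _ hs
        rw [List.sum_eq_zero, smul_zero]
        intro b hb
        simp only [List.mem_map] at hb
        obtain ⟨t, _, rfl⟩ := hb
        refine G.onChain_eq_zero _ ?_
        simp only [Chain.length_append, Chain.length, length_under]
        omega
    rw [hR, G.lin_m]
    generalize under p = q
    cases q with
    | nil => simp [Chain.blocks, Chain.map]
    | snoc q a =>
      exact G.sum_blocksAux q ((Chain.nil _).snoc a) (by simp [Chain.length]) (Chain.nil _)
  map_one x := G.lin_one x
  map_one_eq_zero p q h := G.onChain_eq_zero _ (by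
    simp only [Chain.length_append, Chain.length]; omega)

end

/-- Composition of an `A_∞`-functor with a strict functor:
`(F ∘ G)_n(a_n, …, a₁) = F_n(G(a_n), …, G(a₁))`. -/
def precomp {A B C : UnitalAInfCat K} (G : StrictFunctor A B) (F : AInfFunctor B C) :
    AInfFunctor A C where
  obj x := F.obj (G.obj x)
  map p := F.map (G.mapChain p)
  map_nil x := F.map_nil _
  map_multilinear :=
    { map_add := fun p a b q => by
        simp only [mapChain_append, mapChain_snoc, _root_.map_add]
        exact F.map_multilinear.map_add _ _ _ _
      map_smul := fun p k a q => by
        simp only [mapChain_append, mapChain_snoc, _root_.map_smul]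
        exact F.map_multilinear.map_smul _ _ _ _ }
  map_deg p := by
    rw [← under_mapHomog, ← sdeg_mapHomog G]
    exact F.map_deg _
  map_rel p := by
    have h := F.map_rel (G.mapHomog p)
    rw [under_mapHomog] at h
    have h1 := Chain.blocks_map (H' := B.Hom) (H'' := C.Hom) G.obj (fun a => G.lin a)
      (o' := F.obj) F.map (under p)
    change ((Chain.blocks (H' := C.Hom) (o := fun x => F.obj (G.obj x))
      (fun c => F.map (c.map (H' := B.Hom) G.obj (fun a => G.lin a))) (under p)).map
        fun c => C.m c).sum = _
    rw [← h1]
    refine h.trans ?_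
    unfold barSum
    have h2 : (G.mapHomog p).splits = p.splits.map (fun s =>
        ⟨G.obj s.1, G.mapHomog s.2.1, G.mapHomog s.2.2⟩) := Chain.splits_map _ _ p
    rw [h2, List.map_map]
    congr 1
    refine List.map_congr_left fun s _ => ?_
    have h3 : (G.mapHomog s.2.2).splits = s.2.2.splits.map (fun s =>
        ⟨G.obj s.1, G.mapHomog s.2.1, G.mapHomog s.2.2⟩) := Chain.splits_map _ _ s.2.2
    simp only [Function.comp_def]
    rw [h3, List.map_map, sdeg_mapHomog]
    congr 2
    refine List.map_congr_left fun t _ => ?_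
    simp only [Function.comp_def, under_mapHomog, mapChain_append, mapChain_snoc, G.lin_m]
    rfl
  map_one x := by
    have := F.map_one (G.obj x)
    rw [← G.lin_one] at this
    exact this
  map_one_eq_zero p q h := by
    rw [mapChain_append, mapChain_snoc, G.lin_one]
    exact F.map_one_eq_zero _ _ (by simpa only [length_mapChain] using h)

end StrictFunctor

/-! ## The categories `[n]_K` -/

namespace Simplex

variable (K : Type u) [CommRing K]

/-- The morphisms from `i` to `k` in `[n]_K`: the module `K` (with generator `1`, written `j_{ik}`,
which is the identity if `i = k`) for `i ≤ k`, and zero otherwise. -/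
def hom {n : ℕ} (i k : Fin (n + 1)) : Submodule K K where
  carrier := {a | ¬ i ≤ k → a = 0}
  add_mem' ha hb h := by rw [ha h, hb h, add_zero]
  zero_mem' _ := rfl
  smul_mem' c a ha h := by rw [ha h, smul_zero]

lemma isInternal (M : Type u) [AddCommGroup M] [Module K M] :
    DirectSum.IsInternal (fun k : ℤ => if k = 0 then (⊤ : Submodule K M) else ⊥) := by
  rw [DirectSum.isInternal_submodule_iff_iSupIndep_and_iSup_eq_top]
  constructor
  · intro k
    by_cases hk : k = 0
    · have : (⨆ (j : ℤ) (_ : j ≠ k), if j = 0 then (⊤ : Submodule K M) else ⊥) = ⊥ := by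
        simp only [iSup_eq_bot]
        intro j hj
        rw [if_neg (fun h => hj (h.trans hk.symm))]
      rw [this]
      exact disjoint_bot_right
    · simp only [if_neg hk]
      exact disjoint_bot_left
  · refine top_le_iff.1 ?_
    have := le_iSup (fun k : ℤ => if k = 0 then (⊤ : Submodule K M) else ⊥) 0
    simpa only [if_true] using this

/-- `[n]_K` as a graded quiver, with all morphisms in degree zero. -/
abbrev quiver (n : ℕ) : GradedQuiver.{u, u, 0} K where
  Obj := Fin (n + 1)
  Hom i k := hom K i k
  deg _ _ d := if d = 0 then ⊤ else ⊥
  isInternal _ _ := isInternal K _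

variable {K}

/-- Composition in `[n]_K`, with `j_{kl} ∘ j_{ik} = j_{il}`. -/
def compHom {n : ℕ} {i k l : (quiver K n).Obj} (b : (quiver K n).Hom k l)
    (a : (quiver K n).Hom i k) : (quiver K n).Hom i l :=
  ⟨b.1 * a.1, fun h => by
    by_cases h1 : i ≤ k
    · rw [b.2 (fun h2 => h (h1.trans h2)), zero_mul]
    · rw [a.2 h1, mul_zero]⟩

/-- The operations of `[n]_K`: `m²` is the composition, the other ones vanish. -/
def ops {n : ℕ} {i : (quiver K n).Obj} :
    {k : (quiver K n).Obj} → Chain (quiver K n).Hom i k → (quiver K n).Hom i k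
  | _, .nil _ => 0
  | _, .snoc (.nil _) _ => 0
  | _, .snoc (.snoc (.nil _) a) b => compHom b a
  | _, .snoc (.snoc (.snoc _ _) _) _ => 0

lemma ops_eq_zero {n : ℕ} {i k : (quiver K n).Obj}
    (p : Chain (quiver K n).Hom i k) (h : p.length ≠ 2) : ops p = 0 := by
  match p with
  | .nil _ => rfl
  | .snoc (.nil _) a => rfl
  | .snoc (.snoc (.nil _) a) b => simp [Chain.length] at h
  | .snoc (.snoc (.snoc _ _) _) _ => rfl

lemma mem_deg_zero {n : ℕ} {i k : (quiver K n).Obj} (a : (quiver K n).Hom i k) :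
    a ∈ (quiver K n).deg i k 0 := by
  simp only [if_true]; exact Submodule.mem_top

lemma eq_zero_of_mem_deg {n : ℕ} {i k : (quiver K n).Obj} {d : ℤ} (hd : d ≠ 0)
    {a : (quiver K n).Hom i k} (h : a ∈ (quiver K n).deg i k d) : a = 0 := by
  simpa only [if_neg hd, Submodule.mem_bot] using h

lemma ops_multilinear (n : ℕ) : IsMultilinear (quiver K n) (N := (quiver K n).Hom) ops where
  map_add {x y z t} p a b q := by
    by_cases h : p.length + 1 + q.length = 2
    · cases p with
      | nil =>
        cases q with
        | nil => simp [Chain.length] at h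
        | snoc q c =>
          cases q with
          | nil => exact Subtype.ext (mul_add c.1 a.1 b.1)
          | snoc q d => simp only [Chain.length] at h; omega
      | snoc p c =>
        cases p with
        | nil =>
          cases q with
          | nil => exact Subtype.ext (add_mul a.1 b.1 c.1)
          | snoc q d => simp only [Chain.length] at h; omega
        | snoc p d => simp only [Chain.length] at h; omega
    · have h' : ∀ c : (quiver K n).Hom y z, ops ((p.snoc c).append q) = 0 := fun c =>
        ops_eq_zero _ (by rw [Chain.length_append]; exact h)
      exact ((h' _).trans (add_zero 0).symm).trans (congrArg₂ (· + ·) (h' a) (h' b)).symm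
  map_smul {x y z t} p k a q := by
    by_cases h : p.length + 1 + q.length = 2
    · cases p with
      | nil =>
        cases q with
        | nil => simp [Chain.length] at h
        | snoc q c =>
          cases q with
          | nil => exact Subtype.ext (mul_left_comm c.1 k a.1)
          | snoc q d => simp only [Chain.length] at h; omega
      | snoc p c =>
        cases p with
        | nil =>
          cases q with
          | nil => exact Subtype.ext (mul_assoc k a.1 c.1)
          | snoc q d => simp only [Chain.length] at h; omega
        | snoc p d => simp only [Chain.length] at h; omega
    · have h' : ∀ c : (quiver K n).Hom y z, ops ((p.snoc c).append q) = 0 := fun c =>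
        ops_eq_zero _ (by rw [Chain.length_append]; exact h)
      exact ((h' _).trans (smul_zero k).symm).trans (congrArg (k • ·) (h' a)).symm

lemma length_of_splits {O : Type*} {H : O → O → Type*} {x z : O} {p : Chain H x z}
    {s : Σ y : O, Chain H x y × Chain H y z} (hs : s ∈ p.splits) :
    s.2.1.length + s.2.2.length = p.length := by
  rw [← Chain.length_append, Chain.append_of_splits p s hs]

lemma ops_deg {n : ℕ} {i k : (quiver K n).Obj} (p : Chain (quiver K n).HomogHom i k) :
    ops (under p) ∈ (quiver K n).deg i k (sdeg p + 2) := by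
  match p with
  | .nil _ => exact Submodule.zero_mem _
  | .snoc (.nil _) a => exact Submodule.zero_mem _
  | .snoc (.snoc (.snoc _ _) _) _ => exact Submodule.zero_mem _
  | .snoc (.snoc (.nil _) ⟨d, a⟩) ⟨e, b⟩ =>
    by_cases hd : d = 0
    · by_cases he : e = 0
      · subst hd he
        exact mem_deg_zero _
      · have hb := eq_zero_of_mem_deg he b.2
        have : ops (under (.snoc (.snoc (.nil _) ⟨d, a⟩) ⟨e, b⟩ :
            Chain (quiver K n).HomogHom _ _)) = 0 := by
          change compHom b.1 a.1 = 0
          rw [hb]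
          exact Subtype.ext (zero_mul _)
        rw [this]
        exact Submodule.zero_mem _
    · have ha := eq_zero_of_mem_deg hd a.2
      have : ops (under (.snoc (.snoc (.nil _) ⟨d, a⟩) ⟨e, b⟩ :
          Chain (quiver K n).HomogHom _ _)) = 0 := by
        change compHom b.1 a.1 = 0
        rw [ha]
        exact Subtype.ext (mul_zero _)
      rw [this]
      exact Submodule.zero_mem _

lemma compHom_zero {n : ℕ} {i k l : (quiver K n).Obj} (b : (quiver K n).Hom k l) :
    compHom b (0 : (quiver K n).Hom i k) = 0 := Subtype.ext (mul_zero _)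

lemma zero_compHom {n : ℕ} {i k l : (quiver K n).Obj} (a : (quiver K n).Hom i k) :
    compHom (0 : (quiver K n).Hom k l) a = 0 := Subtype.ext (zero_mul _)

lemma compHom_assoc {n : ℕ} {i k l m : (quiver K n).Obj} (c : (quiver K n).Hom l m) (b : (quiver K n).Hom k l)
    (a : (quiver K n).Hom i k) : compHom (compHom c b) a = compHom c (compHom b a) :=
  Subtype.ext (mul_assoc _ _ _)

lemma ops_rel {n : ℕ} {i k : (quiver K n).Obj} (p : Chain (quiver K n).HomogHom i k) :
    barSum (N := (quiver K n).Hom) ops ops p = 0 := by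
  by_cases hp : p.length = 3
  · match p with
    | .nil _ => simp [Chain.length] at hp
    | .snoc (.nil _) _ => simp [Chain.length] at hp
    | .snoc (.snoc (.nil _) _) _ => simp [Chain.length] at hp
    | .snoc (.snoc (.snoc (.snoc _ _) _) _) _ => simp [Chain.length] at hp
    | .snoc (.snoc (.snoc (.nil _) a) b) c =>
      simp [barSum, Chain.splits, under, Chain.map, Chain.append, sdeg, ops]
      by_cases h : a.1 = 0
      · have hs : (a.1 - 1).negOnePow = -1 := by rw [h]; rfl
        rw [hs, compHom_assoc]
        simp
      · have ha : a.2.1 = 0 := eq_zero_of_mem_deg h a.2.2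
        rw [ha, compHom_zero, compHom_zero, compHom_zero, smul_zero, add_zero]
  · unfold barSum
    refine List.sum_eq_zero fun r hr => ?_
    simp only [List.mem_map] at hr
    obtain ⟨s, hs, rfl⟩ := hr
    rw [List.sum_eq_zero, smul_zero]
    intro r hr
    simp only [List.mem_map] at hr
    obtain ⟨t, ht, rfl⟩ := hr
    have h1 := length_of_splits hs
    have h2 := length_of_splits ht
    by_cases h : t.2.1.length = 2
    · refine ops_eq_zero _ ?_
      have h5 := length_under s.2.1
      have h6 := length_under t.2.2
      rw [Chain.length_append]
      simp only [Chain.length]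
      omega
    · have h3 : ops (under t.2.1) = 0 := ops_eq_zero _ (by
        have := length_under t.2.1
        omega)
      have h4 := (ops_multilinear (K := K) n).map_zero (y := s.1) (z := t.1)
        (under s.2.1) (under t.2.2)
      rw [← h4]
      exact congrArg (fun e => ops ((Chain.snoc (under s.2.1) e).append (under t.2.2))) h3

/-- `[n]_K` as an `A_∞`-category. -/
abbrev cat (K : Type u) [CommRing K] (n : ℕ) : UnitalAInfCat.{u, u, 0} K where
  toGradedQuiver := quiver K n
  m := ops
  m_nil _ := rfl
  m_multilinear := ops_multilinear n
  m_deg := ops_deg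
  m_rel := ops_rel
  one _ := ⟨1, fun h => absurd le_rfl h⟩
  one_mem _ := mem_deg_zero _
  m_one_right f := Subtype.ext (mul_one _)
  m_one_left k g hg := by
    by_cases hk : k = 0
    · subst hk
      rw [Int.negOnePow_zero, one_smul]
      exact Subtype.ext (one_mul _)
    · have h0 : g = 0 := eq_zero_of_mem_deg hk hg
      subst h0
      rw [smul_zero]
      exact Subtype.ext (mul_zero _)
  m_one p q h := ops_eq_zero _ (by
    rw [Chain.length_append]
    simp only [Chain.length]
    omega)

/-- The strict functor `[m]_K → [n]_K` induced by a monotone map `α`, given by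
`j_{ik} ↦ j_{α(i)α(k)}`. -/
def functor {m n : ℕ} (α : Fin (m + 1) →o Fin (n + 1)) : StrictFunctor (cat K m) (cat K n) where
  obj := α
  lin {i k} :=
    { toFun := fun a => ⟨a.1, fun h => a.2 (fun h' => h (α.monotone h'))⟩
      map_add' := fun _ _ => rfl
      map_smul' := fun _ _ => rfl }
  lin_deg d a ha := by
    by_cases hd : d = 0
    · subst hd
      exact mem_deg_zero _
    · have h0 : a = 0 := eq_zero_of_mem_deg hd ha
      subst h0
      rw [_root_.map_zero]
      exact Submodule.zero_mem _
  lin_m p := by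
    match p with
    | .nil _ => rfl
    | .snoc (.nil _) a => rfl
    | .snoc (.snoc (.nil _) a) b => rfl
    | .snoc (.snoc (.snoc _ _) _) _ => rfl
  lin_one _ := rfl

lemma mapChain_id {n : ℕ} {i k : (quiver K n).Obj} (p : Chain (quiver K n).Hom i k) :
    (functor (K := K) (OrderHom.id : Fin (n + 1) →o Fin (n + 1))).mapChain p = p :=
  Chain.map_id p

lemma precomp_id {n : ℕ} {C : UnitalAInfCat.{u, u, u} K} (F : AInfFunctor (cat K n) C) :
    (functor OrderHom.id).precomp F = F := by
  obtain ⟨o, f, h1, h2, h3, h4, h5, h6⟩ := F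
  simp only [StrictFunctor.precomp, mapChain_id]
  rfl

lemma precomp_comp {l m n : ℕ} {C : UnitalAInfCat.{u, u, u} K}
    (α : Fin (m + 1) →o Fin (n + 1)) (β : Fin (l + 1) →o Fin (m + 1))
    (F : AInfFunctor (cat K n) C) :
    (functor (α.comp β)).precomp F = (functor β).precomp ((functor α).precomp F) := by
  have h : ∀ {i k : (quiver K l).Obj} (p : Chain (quiver K l).Hom i k),
      (functor (K := K) α).mapChain ((functor β).mapChain p) = (functor (α.comp β)).mapChain p :=
    fun p => Chain.map_map _ _ _ _ p
  obtain ⟨o, f, h1, h2, h3, h4, h5, h6⟩ := F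
  simp only [StrictFunctor.precomp, h]
  rfl

end Simplex

/-! ## The nerve -/

/-- The `A_∞`-nerve of `C`: its `n`-simplices are the `A_∞`-functors `[n]_K → C`, and monotone maps
act by precomposition. -/
def aInfNerve {K : Type u} [CommRing K] (C : UnitalAInfCat.{u, u, u} K) : SSet.{u} where
  obj n := AInfFunctor (Simplex.cat K n.unop.len) C
  map f := ↾fun F => (Simplex.functor f.unop.toOrderHom).precomp F
  map_id n := by
    ext F
    exact Simplex.precomp_id F
  map_comp f g := by
    ext F
    exact Simplex.precomp_comp f.unop.toOrderHom g.unop.toOrderHom F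


/-- `m¹(1_x) = 0`. -/
lemma UnitalAInfCat.m_single_one {K : Type u} [CommRing K] (C : UnitalAInfCat.{u, v, w} K)
    (x : C.Obj) : C.m ((Chain.nil x).snoc (C.one x)) = 0 := by
  let e : C.HomogHom x x := ⟨0, ⟨C.one x, C.one_mem x⟩⟩
  have hdeg : C.m ((Chain.nil x).snoc (C.one x)) ∈ C.deg x x 1 :=
    C.m_deg (((Chain.nil x).snoc e))
  have hz : ∀ {y z t : C.Obj} (p : Chain C.Hom x y) (q : Chain C.Hom z t),
      C.m ((p.snoc (0 : C.Hom y z)).append q) = 0 := fun p q => C.m_multilinear.map_zero p q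
  have h := C.m_rel (((Chain.nil x).snoc e).snoc e)
  have h1 := C.m_one_left 1 _ hdeg
  have h2 := C.m_one_right (C.m ((Chain.nil x).snoc (C.one x)))
  have h3 := C.m_one_right (C.one x)
  have z1 := hz (Chain.nil x) (((Chain.nil x).snoc (C.one x)).snoc (C.one x))
  have z2 := hz ((Chain.nil x).snoc (C.one x)) ((Chain.nil x).snoc (C.one x))
  have z3 := hz (((Chain.nil x).snoc (C.one x)).snoc (C.one x)) (Chain.nil x)
  simp [Chain.append] at z1 z2 z3
  simp [barSum, Chain.splits, under, Chain.map, Chain.append, sdeg, e, C.m_nil, h1, h2, h3,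
    z1, z2, z3] at h
  exact h

/-- The strict functor `[0]_K → C` with image `x`. -/
def UnitalAInfCat.point {K : Type u} [CommRing K] (C : UnitalAInfCat.{u, u, u} K) (x : C.Obj) :
    StrictFunctor (Simplex.cat K 0) C where
  obj _ := x
  lin := LinearMap.toSpanSingleton K _ (C.one x) ∘ₗ (Submodule.subtype _)
  lin_deg d a ha := by
    by_cases hd : d = 0
    · subst hd
      exact Submodule.smul_mem _ _ (C.one_mem x)
    · have h0 : a = 0 := Simplex.eq_zero_of_mem_deg hd ha
      subst h0
      rw [_root_.map_zero]
      exact Submodule.zero_mem _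
  lin_m p := by
    have hs : ∀ {y : C.Obj} (q : Chain C.Hom y x) (k : K),
        C.m (q.snoc (k • C.one x)) = k • C.m (q.snoc (C.one x)) := fun q k =>
      C.m_multilinear.map_smul q k (C.one x) (Chain.nil x)
    match p with
    | .nil _ => exact (_root_.map_zero _).trans (C.m_nil x).symm
    | .snoc (.nil _) a =>
      refine (_root_.map_zero _).trans ?_
      refine Eq.trans ?_ (hs (Chain.nil x) a.1).symm
      rw [C.m_single_one, smul_zero]
    | .snoc (.snoc (.nil _) a) b =>
      refine Eq.trans ?_ (hs ((Chain.nil x).snoc (a.1 • C.one x)) b.1).symm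
      have h1 : C.m (((Chain.nil x).snoc (a.1 • C.one x)).snoc (C.one x)) = a.1 • C.one x :=
        (C.m_multilinear.map_smul (Chain.nil x) a.1 (C.one x)
          ((Chain.nil x).snoc (C.one x))).trans (congrArg (a.1 • ·) (C.m_one_right _))
      rw [h1, smul_smul]
      rfl
    | .snoc (.snoc (.snoc p a) b) c =>
      refine (_root_.map_zero _).trans ?_
      refine Eq.trans ?_ (hs _ c.1).symm
      have h1 := C.m_one (y := x) (Chain.map (H' := C.Hom) (fun _ => x)
        (fun a => LinearMap.toSpanSingleton K _ (C.one x) (Submodule.subtype _ a))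
        ((p.snoc a).snoc b)) (Chain.nil x) (by simp only [Chain.map, Chain.length]; omega)
      exact (smul_zero c.1).symm.trans (congrArg (c.1 • ·) h1.symm)
  lin_one _ := by simp

namespace aInfNerve

variable {K : Type u} [CommRing K] (C : UnitalAInfCat.{u, u, u} K)

/-- The vertex of the nerve given by an object. -/
def vertex (x : C.Obj) : (aInfNerve C).obj (op (.mk 0)) :=
  (C.point x).toAInfFunctor

end aInfNerve

/-! ## Right mapping spaces -/

namespace SSet

/-- The map `[m + 1] → [n + 1]` which is `α` on `{0, …, m}` and sends the last element to the last
element. -/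
def extendLast {m n : ℕ} (α : SimplexCategory.mk m ⟶ SimplexCategory.mk n) :
    SimplexCategory.mk (m + 1) ⟶ SimplexCategory.mk (n + 1) :=
  SimplexCategory.mkHom
    ⟨Fin.lastCases (Fin.last (n + 1)) (fun i => (α.toOrderHom i).castSucc), by
      intro i j h
      induction j using Fin.lastCases with
      | last => simp only [Fin.lastCases_last]; exact Fin.le_last _
      | cast j =>
        induction i using Fin.lastCases with
        | last => exact absurd h (not_le.2 (Fin.castSucc_lt_last j))
        | cast i =>
          simp only [Fin.lastCases_castSucc, Fin.castSucc_le_castSucc_iff]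
          exact α.toOrderHom.monotone (Fin.castSucc_le_castSucc_iff.1 h)⟩

lemma extendLast_last {m n : ℕ} (α : SimplexCategory.mk m ⟶ SimplexCategory.mk n) :
    (extendLast α).toOrderHom (Fin.last (m + 1)) = Fin.last (n + 1) :=
  Fin.lastCases_last (motive := fun _ => Fin (n + 2))

lemma extendLast_castSucc {m n : ℕ} (α : SimplexCategory.mk m ⟶ SimplexCategory.mk n)
    (i : Fin (m + 1)) :
    (extendLast α).toOrderHom i.castSucc = (α.toOrderHom i).castSucc :=
  Fin.lastCases_castSucc (motive := fun _ => Fin (n + 2)) i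

lemma extendLast_id (n : ℕ) :
    extendLast (𝟙 (SimplexCategory.mk n)) = 𝟙 (SimplexCategory.mk (n + 1)) := by
  ext i : 3
  induction i using Fin.lastCases with
  | last => exact extendLast_last _
  | cast i => exact extendLast_castSucc _ i

lemma extendLast_comp {l m n : ℕ} (α : SimplexCategory.mk l ⟶ SimplexCategory.mk m)
    (β : SimplexCategory.mk m ⟶ SimplexCategory.mk n) :
    extendLast (α ≫ β) = extendLast α ≫ extendLast β := by
  ext i : 3
  induction i using Fin.lastCases with
  | last =>
    refine (extendLast_last _).trans (Eq.symm ?_)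
    exact (congrArg (extendLast β).toOrderHom (extendLast_last α)).trans (extendLast_last β)
  | cast i =>
    refine (extendLast_castSucc _ i).trans (Eq.symm ?_)
    exact (congrArg (extendLast β).toOrderHom (extendLast_castSucc α i)).trans
      (extendLast_castSucc β _)

lemma const_extendLast {m n : ℕ} (α : SimplexCategory.mk m ⟶ SimplexCategory.mk n) :
    SimplexCategory.const (.mk 0) (.mk (m + 1)) (Fin.last _) ≫ extendLast α =
      SimplexCategory.const (.mk 0) (.mk (n + 1)) (Fin.last _) := by
  ext i : 3
  exact extendLast_last α

lemma δ_extendLast {m n : ℕ} (α : SimplexCategory.mk m ⟶ SimplexCategory.mk n) :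
    SimplexCategory.δ (Fin.last (m + 1)) ≫ extendLast α =
      α ≫ SimplexCategory.δ (Fin.last (n + 1)) := by
  ext i : 3
  have h1 : ∀ (k : ℕ) (j : Fin (k + 1)),
      (SimplexCategory.δ (Fin.last (k + 1))).toOrderHom j = j.castSucc := fun k j =>
    Fin.succAbove_last_apply j
  refine (congrArg (extendLast α).toOrderHom (h1 m i)).trans ?_
  exact (extendLast_castSucc α i).trans (h1 n _).symm

/-- The right mapping space `Hom^R_X(x, y)`: its `n`-simplices are the `(n + 1)`-simplices of `X`
whose restriction to `{n + 1}` is `y` and whose restriction to `{0, …, n}` is the degenerate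
`n`-simplex on `x`. -/
def homR (X : SSet.{u}) (x y : X.obj (op (.mk 0))) : SSet.{u} where
  obj n := {σ : X.obj (op (.mk (n.unop.len + 1))) //
    X.map (SimplexCategory.const (.mk 0) (.mk (n.unop.len + 1)) (Fin.last _)).op σ = y ∧
    X.map (SimplexCategory.δ (Fin.last (n.unop.len + 1))).op σ =
      X.map (SimplexCategory.const (.mk n.unop.len) (.mk 0) 0).op x}
  map {n m} f := ↾fun σ =>
    ⟨X.map (extendLast (m := m.unop.len) (n := n.unop.len) f.unop).op σ.1, by
    constructor
    · rw [← types_comp_apply (X.map _) (X.map _), ← X.map_comp, ← op_comp, const_extendLast]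
      exact σ.2.1
    · rw [← types_comp_apply (X.map _) (X.map _), ← X.map_comp, ← op_comp, δ_extendLast,
        op_comp, X.map_comp, types_comp_apply, σ.2.2, ← types_comp_apply (X.map _) (X.map _),
        ← X.map_comp, ← op_comp]
      congr 2⟩
  map_id n := by
    ext σ
    have h : X.map (extendLast (𝟙 (SimplexCategory.mk n.unop.len))).op σ.1 = σ.1 := by
      rw [extendLast_id, op_id, X.map_id]
      rfl
    exact h
  map_comp {l m n} f g := by
    ext σ
    have h : X.map (extendLast (m := n.unop.len) (n := l.unop.len) (g.unop ≫ f.unop)).op σ.1 =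
        X.map (extendLast (m := n.unop.len) (n := m.unop.len) g.unop).op
          (X.map (extendLast (m := m.unop.len) (n := l.unop.len) f.unop).op σ.1) := by
      rw [← types_comp_apply (X.map _) (X.map _), ← X.map_comp, ← op_comp]
      exact congrArg (fun t => X.map t.op σ.1)
        (extendLast_comp (l := n.unop.len) (m := m.unop.len) (n := l.unop.len) g.unop f.unop)
    exact h

end SSet

/-! ## The mapping complex -/

namespace UnitalAInfCat

variable {K : Type u} [CommRing K] (C : UnitalAInfCat.{u, v, w} K)

/-- The differential `m¹ : Homᵏ(x, y) → Hom^{k+1}(x, y)`. -/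
def differential (x y : C.Obj) (k : ℤ) : C.deg x y k →ₗ[K] C.deg x y (k + 1) where
  toFun a := ⟨C.m ((Chain.nil x).snoc a.1), by
    have h := C.m_deg ((Chain.nil x).snoc (⟨k, a⟩ : C.HomogHom x y))
    have e : sdeg ((Chain.nil x).snoc (⟨k, a⟩ : C.HomogHom x y)) + 2 = k + 1 := by
      simp only [sdeg]; ring
    rw [e] at h
    exact h⟩
  map_add' a b := Subtype.ext (C.m_multilinear.map_add (Chain.nil x) a.1 b.1 (Chain.nil y))
  map_smul' c a := Subtype.ext (C.m_multilinear.map_smul (Chain.nil x) c a.1 (Chain.nil y))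

lemma differential_differential (x y : C.Obj) (k : ℤ) (a : C.deg x y k) :
    C.differential x y (k + 1) (C.differential x y k a) = 0 := by
  refine Subtype.ext ?_
  have h := C.m_rel ((Chain.nil x).snoc (⟨k, a⟩ : C.HomogHom x y))
  have z1 : C.m (((Chain.nil x).snoc 0).snoc a.1) = 0 :=
    C.m_multilinear.map_zero (Chain.nil x) ((Chain.nil x).snoc a.1)
  have z2 : C.m (((Chain.nil x).snoc a.1).snoc 0) = 0 :=
    C.m_multilinear.map_zero ((Chain.nil x).snoc a.1) (Chain.nil y)
  simp [barSum, Chain.splits, under, Chain.map, Chain.append, sdeg, C.m_nil, z1, z2] at h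
  exact h

/-- The cochain complex `Map_C(x, y)`: the graded module `Hom(x, y)` with the differential `m¹`. -/
def mapComplex (x y : C.Obj) : CochainComplex (ModuleCat.{v} K) ℤ :=
  CochainComplex.of (fun k => ModuleCat.of K (C.deg x y k))
    (fun k => ModuleCat.ofHom (C.differential x y k))
    (fun k => by
      ext a
      exact congrArg Subtype.val (C.differential_differential x y k a))

/-- The homological truncation `τ_{≥0} Map_C(x, y)`, a chain complex concentrated in nonnegative
degrees: it is `Hom^{-n}(x, y)` in degree `n > 0`, and `ker (m¹ : Hom⁰(x, y) → Hom¹(x, y))` in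
degree `0`. -/
def truncMapComplex (x y : C.Obj) : ChainComplex (ModuleCat.{v} K) ℕ :=
  (C.mapComplex x y).truncLE' ComplexShape.embeddingDownNat

end UnitalAInfCat

/-- The simplicial `K`-module associated with a nonnegatively graded chain complex by the Dold-Kan
correspondence. -/
abbrev doldKan {K : Type u} [CommRing K] (A : ChainComplex (ModuleCat.{u} K) ℕ) :
    SimplicialObject (ModuleCat.{u} K) :=
  Abelian.DoldKan.Γ.obj A

namespace aInfNerve

variable {K : Type u} [CommRing K] (C : UnitalAInfCat.{u, u, u} K)

/-- The right mapping space `Hom^R(x, y)` in the nerve of `C`. -/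
abbrev homR (x y : C.Obj) : SSet.{u} :=
  SSet.homR (aInfNerve C) (vertex C x) (vertex C y)

variable {C}

/-- The `A_∞`-functor `[n + 1]_K → C` underlying an `n`-simplex of `Hom^R(x, y)`. -/
def toFunctor {x y : C.Obj} {n : ℕ} (σ : (homR C x y).obj (op (.mk n))) :
    AInfFunctor (Simplex.cat K (n + 1)) C := σ.1

lemma toFunctor_obj_castSucc {x y : C.Obj} {n : ℕ} (σ : (homR C x y).obj (op (.mk n)))
    (i : Fin (n + 1)) : (toFunctor σ).obj i.castSucc = x := by
  have h := congrArg (fun F : AInfFunctor (Simplex.cat K n) C => F.obj i) σ.2.2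
  rw [← Fin.succAbove_last_apply i]
  exact h

lemma toFunctor_obj_last {x y : C.Obj} {n : ℕ} (σ : (homR C x y).obj (op (.mk n))) :
    (toFunctor σ).obj (Fin.last (n + 1)) = y :=
  congrArg (fun F : AInfFunctor (Simplex.cat K 0) C => F.obj (0 : Fin 1)) σ.2.1

/-- The components of an `n`-simplex of `Hom^R(x, y)` on the chains in `[n + 1]_K` that start in
`{0, …, n}` and end in `n + 1`. (On the chain `i₀ → i₁ → ⋯ → i_m → n + 1` of generators this is the
morphism `f_I : x → y`, for `I = {i₀ < ⋯ < i_m < n + 1}`. All other components are those of the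
degenerate simplex on `x` and of the vertex `y`.) -/
def component {x y : C.Obj} {n : ℕ} (σ : (homR C x y).obj (op (.mk n))) (i : Fin (n + 1))
    (p : Chain (Simplex.cat K (n + 1)).Hom i.castSucc (Fin.last (n + 1))) : C.Hom x y :=
  cast (by rw [toFunctor_obj_castSucc σ i, toFunctor_obj_last σ]) ((toFunctor σ).map p)

end aInfNerve

end

/-!
An `n`-simplex of `Hom^R(x, y)` is an `A_∞`-functor `F : [n + 1]_K → C` that is the degenerate
simplex on `x` on `{0, …, n}`. By multilinearity and unitality, `F` is determined by the morphisms
`f_I : x → y` which it assigns to the chains of generators `i₀ → ⋯ → i_m → n + 1`, for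
`I = {i₀ < ⋯ < i_m} ⊆ {0, …, n}`; here `f_I` has degree `-m`. In the functor equation on such a
chain, the left hand side consists of `m¹(f_I)` and of the term with blocks `(i₀ → i₁)` and the
rest, since `F` vanishes on longer chains in `{0, …, n}` and `m^r` vanishes on units for `r ≥ 3`.
The right hand side consists of the terms in which two consecutive generators are composed.
Together this is the equation `m¹(f_I) + ∑ₖ (-1)ᵏ f_{I ∖ iₖ} = 0`
(`MappingSimplex.functorMap_rel_last`), and the equations on all other chains hold automatically
(`MappingSimplex.functorMap_rel`). Up to the signs `(-1)ᵐ`, such families are the normalized chain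
maps from the standard simplex `Δⁿ` to `τ_{≥0} Map(x, y)`; for `m = 0` the equation says that `f_I`
is a cycle. This identification is linear in `f` and compatible with the simplicial structures
(`MappingSimplex.cochainsIso`).

It remains to identify the simplicial module of normalized chain maps from simplices to a chain
complex `A` with `Γ₀ A` (`DoldKanCochains.isIso_comparison`). The projection of the chains of `Γ₀ A`
onto `A` vanishes on degenerate simplices, so a simplex `z` gives a normalized chain map, with value
on `θ` the component of `θ^* z` in `A`. This comparison map is an isomorphism on normalized Moore
complexes, because a normalized chain map on `Δⁿ` that vanishes on all faces but the one opposite to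
`0` is determined by its value on the top simplex. Hence it is an isomorphism by the Dold–Kan
correspondence.
-/

open GradedQuiver

noncomputable section

/-! ### Dold–Kan via normalized cochains on simplices -/

namespace DoldKanCochains

open AlgebraicTopology AlgebraicTopology.DoldKan SimplicialObject Simplicial Idempotents

variable {K : Type u} [CommRing K] (A : ChainComplex (ModuleCat.{u} K) ℕ)

/-- The normalized chain maps from the simplex `Δ` to `A`: families `g` of elements `g m θ` of `A`
in degree `m`, for all monotone `θ : [m] → Δ`, which vanish on degenerate `θ` and satisfy
`d (g θ) = ∑ (-1)ᵏ g (θ ∘ δₖ)`. -/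
def cochains (Δ : SimplexCategory) : Submodule K (∀ m : ℕ, (⦋m⦌ ⟶ Δ) → A.X m) where
  carrier := {g | (∀ m θ, ¬ Function.Injective θ.toOrderHom → g m θ = 0) ∧
    ∀ m θ, A.d (m + 1) m (g (m + 1) θ) =
      ∑ k : Fin (m + 2), (-1 : ℤ) ^ (k : ℕ) • g m (SimplexCategory.δ k ≫ θ)}
  add_mem' {g h} hg hh := by
    refine ⟨fun m θ hθ => ?_, fun m θ => ?_⟩
    · simp only [Pi.add_apply, hg.1 m θ hθ, hh.1 m θ hθ, add_zero]
    · simp only [Pi.add_apply, map_add, hg.2, hh.2, smul_add, Finset.sum_add_distrib]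
  zero_mem' := by
    refine ⟨fun _ _ _ => rfl, fun m θ => ?_⟩
    simp only [Pi.zero_apply, map_zero, smul_zero, Finset.sum_const_zero]
  smul_mem' c g hg := by
    refine ⟨fun m θ hθ => ?_, fun m θ => ?_⟩
    · simp only [Pi.smul_apply, hg.1 m θ hθ, smul_zero]
    · simp only [Pi.smul_apply, map_smul, hg.2, Finset.smul_sum]
      exact Finset.sum_congr rfl fun _ _ => smul_comm _ _ _

/-- Precomposition with a morphism of simplices. -/
def cochainsMap {Δ Δ' : SimplexCategory} (α : Δ' ⟶ Δ) : cochains A Δ →ₗ[K] cochains A Δ' where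
  toFun g := ⟨fun m θ => g.1 m (θ ≫ α), by
    refine ⟨fun m θ hθ => g.2.1 _ _ fun h => hθ ?_, fun m θ => ?_⟩
    · have h' : Function.Injective (α.toOrderHom ∘ θ.toOrderHom) := h
      exact h'.of_comp
    · simp only [g.2.2, Category.assoc]⟩
  map_add' _ _ := rfl
  map_smul' _ _ := rfl

/-- The simplicial module of normalized chain maps from the standard simplices to `A`. -/
def cochainsObj : SimplicialObject (ModuleCat.{u} K) where
  obj Δ := ModuleCat.of K (cochains A Δ.unop)
  map α := ModuleCat.ofHom (cochainsMap A α.unop)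
  map_id Δ := by
    refine ModuleCat.hom_ext (LinearMap.ext fun g =>
      Subtype.ext (funext fun m => funext fun θ => ?_))
    exact congrArg (g.1 m) (Category.comp_id θ)
  map_comp α β := by
    refine ModuleCat.hom_ext (LinearMap.ext fun g =>
      Subtype.ext (funext fun m => funext fun θ => ?_))
    exact congrArg (g.1 m) (Category.assoc θ _ _).symm

/-- The projection of the unnormalized chains of `Γ₀ A` onto `A`. -/
def projection : (alternatingFaceMapComplex _).obj (Γ₀.obj A) ⟶ A :=
  (Γ₀.splitting A).toNondegComplex ≫ (Γ₀NondegComplexIso A).hom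

/-- The inclusion of `A` into the unnormalized chains of `Γ₀ A`. -/
def inclusion : A ⟶ (alternatingFaceMapComplex _).obj (Γ₀.obj A) :=
  (Γ₀NondegComplexIso A).inv ≫ (Γ₀.splitting A).fromNondegComplex

lemma inclusion_projection : inclusion A ≫ projection A = 𝟙 A := by
  simp [inclusion, projection]

lemma projection_inclusion : projection A ≫ inclusion A = PInfty := by
  simp [inclusion, projection]

lemma PInfty_projection :
    (PInfty : (alternatingFaceMapComplex _).obj (Γ₀.obj A) ⟶ _) ≫ projection A = projection A := by
  simp [projection]

lemma inclusion_PInfty : inclusion A ≫ PInfty = inclusion A := by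
  rw [← projection_inclusion, ← Category.assoc, inclusion_projection, Category.id_comp]

lemma σ_projection {n : ℕ} (i : Fin (n + 1)) :
    (Γ₀.obj A).σ i ≫ (projection A).f (n + 1) = 0 := by
  have h := HomologicalComplex.congr_hom (PInfty_projection A) (n + 1)
  rw [HomologicalComplex.comp_f] at h
  rw [← h]
  have h2 := σ_comp_PInfty (Γ₀.obj A) i
  rw [← Category.assoc]
  erw [h2]
  rw [Limits.zero_comp]

lemma alternatingFaceMapComplex_d_apply (X : SimplicialObject (ModuleCat.{u} K)) (n : ℕ)
    (x : X.obj (op ⦋n + 1⦌)) :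
    ((alternatingFaceMapComplex _).obj X).d (n + 1) n x =
      ∑ k : Fin (n + 2), (-1 : ℤ) ^ (k : ℕ) • X.δ k x := by
  rw [alternatingFaceMapComplex_obj_d, AlternatingFaceMapComplex.objD]
  change ModuleCat.Hom.hom _ x = _
  rw [ModuleCat.hom_sum, LinearMap.sum_apply]
  rfl

variable {A} in
/-- A chain map `r` from the chains of a simplicial module `X` to `A` that vanishes on degeneracies
yields a map to the cochains: a simplex `z` of `X` gives the cochain `θ ↦ r (θ^* z)`. -/
def toCochains {X : SimplicialObject (ModuleCat.{u} K)}
    (r : (alternatingFaceMapComplex _).obj X ⟶ A)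
    (hr : ∀ n (i : Fin (n + 1)), X.σ i ≫ r.f (n + 1) = 0) : X ⟶ cochainsObj A where
  app Δ := ModuleCat.ofHom
    { toFun z := ⟨fun m θ => r.f m (X.map θ.op z), by
        refine ⟨fun m θ hθ => ?_, fun m θ => ?_⟩
        · obtain _ | m := m
          · exact absurd (fun a b _ => Subsingleton.elim (α := Fin 1) a b) hθ
          obtain ⟨i, θ', rfl⟩ := SimplexCategory.eq_σ_comp_of_not_injective θ hθ
          have h := congrArg (fun f => r.f (m + 1) (f.hom z))
            (X.map_comp θ'.op (SimplexCategory.σ i).op)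
          exact h.trans (congrArg (fun f => f.hom (X.map θ'.op z)) (hr m i))
        · have h := congrArg (fun f => f.hom (X.map θ.op z)) (r.comm (m + 1) m)
          refine h.trans ((congrArg (r.f m) (alternatingFaceMapComplex_d_apply X m _)).trans ?_)
          refine (map_sum (r.f m).hom _ _).trans (Finset.sum_congr rfl fun k _ => ?_)
          refine (map_zsmul (r.f m).hom _ _).trans (congrArg _ (congrArg (r.f m).hom ?_))
          rw [op_comp, Functor.map_comp]
          rfl⟩
      map_add' z w := by
        refine Subtype.ext (funext fun m => funext fun θ => ?_)
        exact map_add ((r.f m).hom ∘ₗ (X.map θ.op).hom) z w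
      map_smul' c z := by
        refine Subtype.ext (funext fun m => funext fun θ => ?_)
        exact map_smul ((r.f m).hom ∘ₗ (X.map θ.op).hom) c z }
  naturality Δ Δ' α := by
    refine ModuleCat.hom_ext (LinearMap.ext fun z =>
      Subtype.ext (funext fun m => funext fun θ => ?_))
    have h := congrArg (fun f => r.f m (f.hom z)) (X.map_comp α θ.op)
    exact h.symm

/-- The comparison map: a simplex `z` of `Γ₀ A` gives the cochain that maps `θ` to the component of
`θ^* z` in `A`. -/
def comparison : Γ₀.obj A ⟶ cochainsObj A := toCochains (projection A) fun _ => σ_projection A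

/-- Evaluation of cochains on `[n]` at the nondegenerate `n`-simplex, a chain map to `A`. -/
def evaluation : (alternatingFaceMapComplex _).obj (cochainsObj A) ⟶ A where
  f n := ModuleCat.ofHom
    { toFun g := g.1 n (𝟙 _)
      map_add' _ _ := rfl
      map_smul' _ _ := rfl }
  comm' i j hij := by
    obtain rfl : j + 1 = i := hij
    refine ModuleCat.hom_ext (LinearMap.ext fun g => ?_)
    refine (g.2.2 j (𝟙 _)).trans ?_
    refine Eq.trans ?_ (congrArg (fun t : cochains A ⦋j⦌ => t.1 j (𝟙 _))
      (alternatingFaceMapComplex_d_apply (cochainsObj A) j g)).symm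
    refine Eq.trans ?_ (map_sum (((LinearMap.proj (𝟙 ⦋j⦌) : ((⦋j⦌ ⟶ ⦋j⦌) → A.X j) →ₗ[K] A.X j) ∘ₗ
      (LinearMap.proj j : (∀ m, (⦋m⦌ ⟶ ⦋j⦌) → A.X m) →ₗ[K] _)) ∘ₗ
        (cochains A ⦋j⦌).subtype) _ _).symm
    refine Finset.sum_congr rfl fun k _ => congrArg ((-1 : ℤ) ^ (k : ℕ) • ·) ?_
    refine congrArg (g.1 j) ?_
    exact (Category.comp_id _).trans (Category.id_comp _).symm

lemma comparison_evaluation :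
    (alternatingFaceMapComplex _).map (comparison A) ≫ evaluation A = projection A := by
  ext n : 1
  refine ModuleCat.hom_ext (LinearMap.ext fun z => ?_)
  exact congrArg (fun f => (projection A).f n (f.hom z)) ((Γ₀.obj A).map_id _)

variable {A}

/-- Apart from the identity, no map to `[n]` is both injective and surjective. -/
lemma eq_zero_of_nonsurjective {n : ℕ} (w : cochains A ⦋n⦌) (h0 : w.1 n (𝟙 _) = 0)
    (h : ∀ m (θ : ⦋m⦌ ⟶ ⦋n⦌), ¬ Function.Surjective θ.toOrderHom → w.1 m θ = 0) : w = 0 := by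
  refine Subtype.ext (funext fun m => funext fun θ => ?_)
  by_cases hi : Function.Injective θ.toOrderHom
  · by_cases hs : Function.Surjective θ.toOrderHom
    · have : Mono θ := SimplexCategory.mono_iff_injective.2 hi
      have : Epi θ := SimplexCategory.epi_iff_surjective.2 hs
      obtain rfl : m = n := le_antisymm (SimplexCategory.len_le_of_mono θ)
        (SimplexCategory.len_le_of_epi θ)
      rw [SimplexCategory.eq_id_of_mono θ]
      exact h0
    · exact h m θ hs
  · exact w.2.1 m θ hi

/-- A cochain in the normalized Moore complex is determined by its value on the nondegenerate
simplex. -/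
lemma eq_zero_of_faces {n : ℕ} (w : cochains A ⦋n + 1⦌) (h0 : w.1 (n + 1) (𝟙 _) = 0)
    (h : ∀ k : Fin (n + 1), cochainsMap A (SimplexCategory.δ k.succ) w = 0) : w = 0 := by
  have h' : ∀ (k : Fin (n + 1)) m (θ : ⦋m⦌ ⟶ ⦋n⦌), w.1 m (θ ≫ SimplexCategory.δ k.succ) = 0 :=
    fun k m θ => congrFun (congrFun (congrArg Subtype.val (h k)) m) θ
  -- the face opposite to `0` vanishes as well: its value on the top simplex is `d (w id)`
  have hz : cochainsMap A (SimplexCategory.δ 0) w = 0 := by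
    refine eq_zero_of_nonsurjective _ ?_ fun m θ hθ => ?_
    · have h1 := w.2.2 n (𝟙 _)
      rw [h0, map_zero, Fin.sum_univ_succ, Finset.sum_eq_zero, add_zero] at h1
      · simp only [Fin.val_zero, pow_zero, one_smul, Category.comp_id] at h1
        exact (congrArg (w.1 n) (Category.id_comp _)).trans h1.symm
      · intro k _
        have := h' k n (𝟙 _)
        rw [Category.id_comp] at this
        rw [Category.comp_id, this, smul_zero]
    · obtain _ | n := n
      · exact absurd (fun b => ⟨0, Subsingleton.elim (α := Fin 1) _ _⟩) hθ
      obtain ⟨j, θ', rfl⟩ := SimplexCategory.eq_comp_δ_of_not_surjective θ hθ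
      have h1 := h' j m (θ' ≫ SimplexCategory.δ 0)
      rw [Category.assoc] at h1
      refine Eq.trans (congrArg (w.1 m) ?_) h1
      rw [Category.assoc]
      exact congrArg (θ' ≫ ·) (SimplexCategory.δ_comp_δ (Fin.zero_le j)).symm
  refine eq_zero_of_nonsurjective w h0 fun m θ hθ => ?_
  obtain ⟨j, θ', rfl⟩ := SimplexCategory.eq_comp_δ_of_not_surjective θ hθ
  induction j using Fin.cases with
  | zero => exact congrFun (congrFun (congrArg Subtype.val hz) m) θ'
  | succ k => exact h' k m θ'

lemma cochainsMap_δ_PInfty {n : ℕ} (k : Fin (n + 1)) (g : cochains A ⦋n + 1⦌) :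
    cochainsMap A (SimplexCategory.δ k.succ)
      ((PInfty : (alternatingFaceMapComplex _).obj (cochainsObj A) ⟶ _).f (n + 1) g) = 0 := by
  have h := HigherFacesVanish.of_P (X := cochainsObj A) (n + 1) n k (by omega)
  exact congrArg (fun f => f.hom g) h

variable (A)

lemma map_comparison_PInfty :
    PInfty ≫ (alternatingFaceMapComplex _).map (comparison A) =
      (alternatingFaceMapComplex _).map (comparison A) ≫ PInfty := by
  ext n : 1
  exact (PInfty_f_naturality n (comparison A)).symm

/-- On normalized chains of the cochains, `evaluation A` followed by the inclusion of `A` is the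
identity: both sides agree after `evaluation A`, which is injective on the normalized Moore complex
by `eq_zero_of_faces`. -/
lemma PInfty_evaluation_inclusion_comparison :
    PInfty ≫ evaluation A ≫ inclusion A ≫ (alternatingFaceMapComplex _).map (comparison A) =
      PInfty := by
  have h1 : inclusion A ≫ (alternatingFaceMapComplex _).map (comparison A) =
      inclusion A ≫ (alternatingFaceMapComplex _).map (comparison A) ≫ PInfty := by
    rw [← map_comparison_PInfty, ← Category.assoc, inclusion_PInfty]
  have h2 : (PInfty ≫ evaluation A ≫ inclusion A ≫
      (alternatingFaceMapComplex _).map (comparison A)) ≫ evaluation A = PInfty ≫ evaluation A := by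
    simp only [Category.assoc]
    rw [comparison_evaluation, inclusion_projection, Category.comp_id]
  have h3 : PInfty ≫ evaluation A ≫ inclusion A ≫
      (alternatingFaceMapComplex _).map (comparison A) =
      (PInfty ≫ evaluation A ≫ inclusion A ≫
      (alternatingFaceMapComplex _).map (comparison A)) ≫ PInfty := by
    simp only [Category.assoc]
    rw [← h1]
  generalize PInfty ≫ evaluation A ≫ inclusion A ≫
    (alternatingFaceMapComplex _).map (comparison A) = ψ at h2 h3
  ext n : 1
  refine ModuleCat.hom_ext (LinearMap.ext fun g => ?_)
  rw [← sub_eq_zero]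
  have e2 := congrArg (fun f => f.hom g) (HomologicalComplex.congr_hom h2 n)
  have e3 := congrArg (fun f => f.hom g) (HomologicalComplex.congr_hom h3 n)
  have e4 : ∀ t t' : cochains A ⦋n⦌, (t - t').1 n (𝟙 _) = t.1 n (𝟙 _) - t'.1 n (𝟙 _) :=
    fun _ _ => rfl
  obtain _ | n := n
  · refine eq_zero_of_nonsurjective _ ((e4 _ _).trans (sub_eq_zero.2 e2)) fun m θ hθ => ?_
    exact absurd (fun b => ⟨0, Subsingleton.elim (α := Fin 1) _ _⟩) hθ
  · refine eq_zero_of_faces _ ((e4 _ _).trans (sub_eq_zero.2 e2)) fun k => ?_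
    refine (map_sub (cochainsMap A (SimplexCategory.δ k.succ)) _ _).trans ?_
    rw [sub_eq_zero]
    refine Eq.trans ?_ (cochainsMap_δ_PInfty k g).symm
    refine (congrArg (cochainsMap A (SimplexCategory.δ k.succ)) e3).trans ?_
    exact cochainsMap_δ_PInfty k _

/-- `Γ₀ A` is the simplicial module of normalized chain maps from simplices to `A`. -/
lemma isIso_comparison : IsIso (comparison A) := by
  -- `N₁` reflects isomorphisms, and the inverse on normalized chains is given by the evaluation
  have : IsIso (N₁.map (comparison A)) := by
    refine ⟨⟨⟨PInfty ≫ evaluation A ≫ inclusion A, ?_⟩, ?_, ?_⟩⟩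
    · change PInfty ≫ (PInfty ≫ evaluation A ≫ inclusion A) ≫ PInfty = _
      simp only [Category.assoc, inclusion_PInfty, PInfty_idem_assoc]
    · ext : 1
      change (PInfty ≫ (alternatingFaceMapComplex _).map (comparison A)) ≫
        PInfty ≫ evaluation A ≫ inclusion A = PInfty
      rw [map_comparison_PInfty, Category.assoc, PInfty_idem_assoc,
        ← Category.assoc _ PInfty, ← map_comparison_PInfty, Category.assoc,
        ← Category.assoc ((alternatingFaceMapComplex _).map _), comparison_evaluation,
        projection_inclusion, PInfty_idem]
    · ext : 1
      change (PInfty ≫ evaluation A ≫ inclusion A) ≫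
        PInfty ≫ (alternatingFaceMapComplex _).map (comparison A) = PInfty
      rw [Category.assoc, Category.assoc, ← Category.assoc (inclusion A), inclusion_PInfty,
        PInfty_evaluation_inclusion_comparison]
  exact isIso_of_reflects_iso (comparison A) N₁

end DoldKanCochains

/-! ### The truncated mapping complex -/

namespace HomologicalComplex

variable {ι ι' : Type*} {c : ComplexShape ι} {c' : ComplexShape ι'} {V : Type*} [Category V]
  [Limits.HasZeroMorphisms V] (L : HomologicalComplex V c') (e : c.Embedding c') [e.IsTruncLE]
  [∀ i', L.HasHomology i']

lemma truncLE'ToRestriction_f_eq_iCycles {i : ι} (hi : e.BoundaryLE i) :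
    (L.truncLE'ToRestriction e).f i =
      (L.truncLE'XIsoCycles e rfl hi).hom ≫ L.iCycles (e.f i) := by
  apply Quiver.Hom.op_inj
  refine (restrictionToTruncGE'_f_eq_iso_hom_pOpcycles_iso_inv L.op e.op rfl (by simpa)).trans ?_
  have h : L.op.pOpcycles (e.f i) = (L.iCycles (e.f i)).op ≫ (L.opcyclesOpIso (e.f i)).inv :=
    (Iso.eq_comp_inv _).2 (L.sc (e.f i)).op_pOpcycles_opcyclesOpIso_hom
  refine (Category.id_comp _).trans ((congrArg (· ≫ _) h).trans ?_)
  exact Category.assoc _ _ _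

end HomologicalComplex

namespace UnitalAInfCat

variable {K : Type u} [CommRing K] (C : UnitalAInfCat.{u, u, u} K)

lemma mapComplex_d (x y : C.Obj) {k l : ℤ} (h : k + 1 = l) (a : C.deg x y k) :
    ((C.mapComplex x y).d k l a : C.deg x y l).1 = C.m ((Chain.nil x).snoc a.1) := by
  subst h
  have h : (C.mapComplex x y).d k (k + 1) = ModuleCat.ofHom (C.differential x y k) :=
    CochainComplex.of_d (fun k => ModuleCat.of K (C.deg x y k))
      (fun k => ModuleCat.ofHom (C.differential x y k)) k
  exact congrArg (fun f => (f.hom a : C.deg x y (k + 1)).1) h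

/-- The inclusion of the truncated mapping complex into the module of all morphisms. -/
def truncInclusion (x y : C.Obj) (m : ℕ) : (C.truncMapComplex x y).X m →ₗ[K] C.Hom x y :=
  (C.deg x y (-(m : ℤ))).subtype ∘ₗ
    (((C.mapComplex x y).truncLE'ToRestriction ComplexShape.embeddingDownNat).f m).hom

lemma truncInclusion_injective (x y : C.Obj) (m : ℕ) :
    Function.Injective (C.truncInclusion x y m) := by
  refine Function.Injective.comp (g := (C.deg x y (-(m : ℤ))).subtype) Subtype.val_injective ?_
  exact (ModuleCat.mono_iff_injective _).1 inferInstance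

lemma truncInclusion_mem (x y : C.Obj) (m : ℕ) (a) :
    C.truncInclusion x y m a ∈ C.deg x y (-(m : ℤ)) :=
  Subtype.property _

lemma m_truncInclusion (x y : C.Obj) (m : ℕ) (a : (C.truncMapComplex x y).X (m + 1)) :
    C.m ((Chain.nil x).snoc (C.truncInclusion x y (m + 1) a)) =
      C.truncInclusion x y m ((C.truncMapComplex x y).d (m + 1) m a) := by
  have h := ((C.mapComplex x y).truncLE'ToRestriction ComplexShape.embeddingDownNat).comm (m + 1) m
  have h' := congrArg (fun f => (f.hom a : C.deg x y (-(m : ℤ))).1) h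
  refine Eq.trans (Eq.symm ?_) h'
  exact C.mapComplex_d x y (by simp) _

lemma boundaryLE_zero : ComplexShape.embeddingDownNat.BoundaryLE 0 := by
  refine ComplexShape.Embedding.boundaryLE _ (k' := 1) (by simp) fun i => ?_
  simp
  omega

lemma m_truncInclusion_zero (x y : C.Obj) (a : (C.truncMapComplex x y).X 0) :
    C.m ((Chain.nil x).snoc (C.truncInclusion x y 0 a)) = 0 := by
  have h : ((C.mapComplex x y).truncLE'XIsoCycles ComplexShape.embeddingDownNat rfl
      boundaryLE_zero).hom ≫ (C.mapComplex x y).iCycles _ ≫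
      (C.mapComplex x y).d (ComplexShape.embeddingDownNat.f 0) 1 = 0 := by
    rw [HomologicalComplex.iCycles_d, Limits.comp_zero]
  have h' := congrArg
    (fun f => (C.mapComplex x y).d (ComplexShape.embeddingDownNat.f 0) 1 (f.hom a))
    ((C.mapComplex x y).truncLE'ToRestriction_f_eq_iCycles ComplexShape.embeddingDownNat
      boundaryLE_zero)
  have h'' := h'.trans (congrArg (fun f => f.hom a) h)
  exact (C.mapComplex_d x y (by simp) _).symm.trans
    (congrArg (fun t : C.deg x y 1 => t.1) h'')

lemma exists_truncInclusion_eq (x y : C.Obj) (m : ℕ) (a : C.Hom x y) (ha : a ∈ C.deg x y (-(m : ℤ)))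
    (h : m = 0 → C.m ((Chain.nil x).snoc a) = 0) : ∃ b, C.truncInclusion x y m b = a := by
  obtain _ | m := m
  · let a' : (C.mapComplex x y).X (ComplexShape.embeddingDownNat.f 0) := ⟨a, ha⟩
    have h0 : (C.mapComplex x y).d (ComplexShape.embeddingDownNat.f 0) 1 a' = 0 :=
      Subtype.ext ((C.mapComplex_d x y (by simp) _).trans (h rfl))
    let f : ModuleCat.of K K ⟶ (C.mapComplex x y).X (ComplexShape.embeddingDownNat.f 0) :=
      ModuleCat.ofHom (LinearMap.toSpanSingleton K _ a')
    have hf : f ≫ (C.mapComplex x y).d (ComplexShape.embeddingDownNat.f 0) 1 = 0 := by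
      refine ModuleCat.hom_ext (LinearMap.ext_ring ?_)
      refine Eq.trans ?_ h0
      exact congrArg ((C.mapComplex x y).d (ComplexShape.embeddingDownNat.f 0) 1) (one_smul K a')
    let g := (C.mapComplex x y).liftCycles f 1 (by simp) hf ≫
      ((C.mapComplex x y).truncLE'XIsoCycles ComplexShape.embeddingDownNat rfl boundaryLE_zero).inv
    have hg : g ≫ ((C.mapComplex x y).truncLE'XIsoCycles ComplexShape.embeddingDownNat rfl
        boundaryLE_zero).hom ≫ (C.mapComplex x y).iCycles _ = f := by simp [g]
    have h' := congrArg (fun f => f.hom (g.hom (1 : K)))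
      ((C.mapComplex x y).truncLE'ToRestriction_f_eq_iCycles ComplexShape.embeddingDownNat
        boundaryLE_zero)
    have h'' := h'.trans ((congrArg (fun f => f.hom (1 : K)) hg).trans (one_smul K a'))
    exact ⟨g.hom (1 : K), congrArg Subtype.val h''⟩
  · have := (C.mapComplex x y).isIso_truncLE'ToRestriction ComplexShape.embeddingDownNat (m + 1)
      (ComplexShape.Embedding.not_boundaryLE_prev _ (j := m) (by simp))
    obtain ⟨b, hb⟩ := (ConcreteCategory.bijective_of_isIso
      (((C.mapComplex x y).truncLE'ToRestriction ComplexShape.embeddingDownNat).f (m + 1))).2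
        ⟨a, ha⟩
    exact ⟨b, congrArg Subtype.val hb⟩

end UnitalAInfCat

/-! ### Chains containing zero, and sums over blocks and splittings -/

namespace Chain

variable {O : Type*} {H : O → O → Type*}

lemma mem_blocksAux_length {O' : Type*} {H' : O' → O' → Type*} {o : O → O'}
    (φ : ∀ {x y : O}, Chain H x y → H' (o x) (o y)) {x y z : O} (p : Chain H x y)
    (s : Chain H y z) : ∀ c ∈ blocksAux (H' := H') (o := o) φ p s, 1 ≤ c.length := by
  induction p generalizing z with
  | nil =>
    intro c hc
    simp only [blocksAux, List.mem_singleton] at hc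
    subst hc
    simp [length]
  | snoc p a ih =>
    intro c hc
    simp only [blocksAux, List.mem_append, List.mem_map] at hc
    rcases hc with ⟨c', _, rfl⟩ | hc
    · simp [length]
    · exact ih _ c hc

/-- A sum over block decompositions in which only the decomposition into a single block
contributes. -/
lemma sum_blocksAux_eq_single {O' : Type*} {H' : O' → O' → Type*} {o : O → O'} {M : Type*}
    [AddCommMonoid M] (φ : ∀ {x y : O}, Chain H x y → H' (o x) (o y)) {x y z : O}
    (p : Chain H x y) (s : Chain H y z) (g : Chain H' (o x) (o z) → M)
    (hg : ∀ c, 2 ≤ c.length → g c = 0) :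
    ((blocksAux (H' := H') (o := o) φ p s).map g).sum = g ((nil _).snoc (φ (p.append s))) := by
  induction p generalizing z with
  | nil => simp [blocksAux, nil_append]
  | snoc p a ih =>
    simp only [blocksAux, List.map_append, List.sum_append, List.map_map]
    rw [ih ((snoc (nil _) a).append s) g hg, List.sum_eq_zero, zero_add, ← append_assoc]
    · rfl
    · intro b hb
      simp only [List.mem_map, Function.comp_apply] at hb
      obtain ⟨c, hc, rfl⟩ := hb
      refine hg _ ?_
      have := mem_blocksAux_length (o := o) φ p _ c hc
      simp only [length]
      omega

/-- A sum over splittings that depends only on the length of the first part. -/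
lemma sum_splits_eq_range {M : Type*} [AddCommMonoid M] {x z : O} (p : Chain H x z) (g : ℕ → M) :
    (p.splits.map fun s => g s.2.1.length).sum = ∑ j ∈ Finset.range (p.length + 1), g j := by
  induction p with
  | nil => simp [splits, length]
  | snoc p a ih =>
    simp only [splits, List.map_cons, List.sum_cons, List.map_map, Function.comp_def, length]
    rw [ih, Finset.sum_range_succ _ (p.length + 1), add_comm]

end Chain

namespace GradedQuiver

variable {K : Type u} [CommRing K] {G : GradedQuiver.{u, v, w} K}

/-- Some element of the chain is zero. -/
def HasZero {x : G.Obj} : {y : G.Obj} → Chain G.Hom x y → Prop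
  | _, .nil _ => False
  | _, .snoc p a => HasZero p ∨ a = 0

lemma hasZero_append {x y z : G.Obj} (p : Chain G.Hom x y) (q : Chain G.Hom y z) :
    HasZero (p.append q) ↔ HasZero p ∨ HasZero q := by
  induction q with
  | nil => simp [Chain.append, HasZero]
  | snoc q a ih => simp only [Chain.append, HasZero, ih, or_assoc]

lemma IsMultilinear.eq_zero_of_hasZero {N : G.Obj → G.Obj → Type*}
    [∀ x y, AddCommGroup (N x y)] [∀ x y, Module K (N x y)]
    {φ : ∀ {x y : G.Obj}, Chain G.Hom x y → N x y} (h : IsMultilinear G (N := N) φ)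
    {x y : G.Obj} (p : Chain G.Hom x y) (hp : HasZero p) : φ p = 0 := by
  suffices ∀ {z : G.Obj} (q : Chain G.Hom y z), φ (p.append q) = 0 from this (.nil _)
  induction p with
  | nil => exact hp.elim
  | snoc p a ih =>
    intro z q
    rcases hp with hp | rfl
    · have := ih hp (((Chain.nil _).snoc a).append q)
      rwa [← Chain.append_assoc] at this
    · exact h.map_zero p q

lemma under_append {x y z : G.Obj} (p : Chain G.HomogHom x y) (q : Chain G.HomogHom y z) :
    under (p.append q) = (under p).append (under q) := Chain.map_append _ _ p q

lemma barSum_eq_zero_of_hasZero {N : G.Obj → G.Obj → Type*} [∀ x y, AddCommGroup (N x y)]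
    [∀ x y, Module K (N x y)]
    {μ : ∀ {x y : G.Obj}, Chain G.Hom x y → G.Hom x y} (hμ : IsMultilinear G (N := G.Hom) μ)
    {φ : ∀ {x y : G.Obj}, Chain G.Hom x y → N x y} (hφ : IsMultilinear G (N := N) φ)
    {x y : G.Obj} (p : Chain G.HomogHom x y) (hp : HasZero (under p)) :
    barSum (N := N) μ φ p = 0 := by
  refine List.sum_eq_zero fun r hr => ?_
  simp only [List.mem_map] at hr
  obtain ⟨s, hs, rfl⟩ := hr
  rw [List.sum_eq_zero, smul_zero]
  intro r hr
  simp only [List.mem_map] at hr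
  obtain ⟨t, ht, rfl⟩ := hr
  refine hφ.eq_zero_of_hasZero _ ?_
  rw [← Chain.append_of_splits p s hs, ← Chain.append_of_splits _ t ht, under_append,
    under_append, hasZero_append, hasZero_append] at hp
  rw [hasZero_append]
  rcases hp with h | h | h
  · exact Or.inl (Or.inl h)
  · exact Or.inl (Or.inr (hμ.eq_zero_of_hasZero _ h))
  · exact Or.inr h

section blocks

variable {G' : GradedQuiver.{u} K} {o : G.Obj → G'.Obj}
  {φ : ∀ {x y : G.Obj}, Chain G.Hom x y → G'.Hom (o x) (o y)}

lemma hasZero_of_mem_blocksAux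
    (hφ : IsMultilinear G (N := fun x y => G'.Hom (o x) (o y)) φ) {x y z : G.Obj}
    (p : Chain G.Hom x y) (s : Chain G.Hom y z) (h : HasZero p ∨ HasZero s) :
    ∀ c ∈ Chain.blocksAux (H' := G'.Hom) (o := o) φ p s, HasZero c := by
  induction p generalizing z with
  | nil =>
    intro c hc
    simp only [Chain.blocksAux, List.mem_singleton] at hc
    subst hc
    exact Or.inr (hφ.eq_zero_of_hasZero _ (h.resolve_left id))
  | snoc p a ih =>
    intro c hc
    simp only [Chain.blocksAux, List.mem_append, List.mem_map] at hc
    rcases hc with ⟨c, hc, rfl⟩ | hc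
    · rcases h with h | h
      · exact Or.inl (ih _ (h.imp_right fun h' =>
          show HasZero (Chain.snoc (Chain.nil _) a) from Or.inr h') c hc)
      · exact Or.inr (hφ.eq_zero_of_hasZero _ h)
    · refine ih _ ?_ c hc
      rw [hasZero_append]
      rcases h with (h | h) | h
      · exact Or.inl h
      · exact Or.inr (Or.inl (Or.inr h))
      · exact Or.inr (Or.inr h)

/-- If `φ` vanishes on all chains ending in `s`, then a decomposition whose last block contains `s`
is mapped to a chain containing zero. -/
lemma hasZero_of_mem_blocksAux_of_forall_append {x y z : G.Obj} (p : Chain G.Hom x y)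
    (s : Chain G.Hom y z) (h : ∀ {x' : G.Obj} (q : Chain G.Hom x' y), φ (q.append s) = 0) :
    ∀ c ∈ Chain.blocksAux (H' := G'.Hom) (o := o) φ p s, HasZero c := by
  induction p generalizing z with
  | nil =>
    intro c hc
    simp only [Chain.blocksAux, List.mem_singleton] at hc
    subst hc
    have := h (.nil _)
    rw [Chain.nil_append] at this
    exact Or.inr this
  | snoc p a ih =>
    intro c hc
    simp only [Chain.blocksAux, List.mem_append, List.mem_map] at hc
    rcases hc with ⟨c, hc, rfl⟩ | hc
    · have := h (.nil _)
      rw [Chain.nil_append] at this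
      exact Or.inr this
    · refine ih _ (fun q => ?_) c hc
      rw [← Chain.append_assoc]
      exact h _

end blocks

end GradedQuiver

/-! ### Chains in the simplex categories -/

namespace Simplex

variable {K : Type u} [CommRing K] {N : ℕ}

/-- The product of the coefficients of a chain in `[N]_K`. -/
def coef {i : Fin (N + 1)} : {k : Fin (N + 1)} → Chain (quiver K N).Hom i k → K
  | _, .nil _ => 1
  | _, .snoc p a => coef p * a.1

/-- The list of all vertices of a chain in `[N]_K` except for the last one. -/
def sources {i : Fin (N + 1)} : {k : Fin (N + 1)} → Chain (quiver K N).Hom i k →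
    List (Fin (N + 1))
  | _, .nil _ => []
  | _, .snoc (y := j) p _ => sources p ++ [j]

lemma coef_append {i j k : Fin (N + 1)} (p : Chain (quiver K N).Hom i j)
    (q : Chain (quiver K N).Hom j k) : coef (p.append q) = coef p * coef q := by
  induction q with
  | nil => simp [Chain.append, coef]
  | snoc q a ih => simp only [Chain.append, coef, ih, mul_assoc]

lemma sources_append {i j k : Fin (N + 1)} (p : Chain (quiver K N).Hom i j)
    (q : Chain (quiver K N).Hom j k) : sources (p.append q) = sources p ++ sources q := by
  induction q with
  | nil => simp [Chain.append, sources]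
  | snoc q a ih => simp only [Chain.append, sources, ih, List.append_assoc]

lemma coef_append_add {i j k l : Fin (N + 1)} (p : Chain (quiver K N).Hom i j)
    (a b : (quiver K N).Hom j k) (q : Chain (quiver K N).Hom k l) :
    coef ((p.snoc (a + b)).append q) = coef ((p.snoc a).append q) + coef ((p.snoc b).append q) := by
  refine (coef_append (p.snoc (a + b)) q).trans (Eq.trans ?_ (congrArg₂ (· + ·)
    (coef_append (p.snoc a) q) (coef_append (p.snoc b) q)).symm)
  exact (congrArg (· * coef q) (mul_add (coef p) a.1 b.1)).trans (add_mul _ _ _)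

lemma coef_append_smul {i j k l : Fin (N + 1)} (p : Chain (quiver K N).Hom i j) (c : K)
    (a : (quiver K N).Hom j k) (q : Chain (quiver K N).Hom k l) :
    coef ((p.snoc (c • a)).append q) = c * coef ((p.snoc a).append q) := by
  refine (coef_append (p.snoc (c • a)) q).trans (Eq.trans ?_ (congrArg (c * ·)
    (coef_append (p.snoc a) q)).symm)
  exact (congrArg (· * coef q) (mul_left_comm (coef p) c a.1)).trans (mul_assoc _ _ _)

lemma sources_append_congr {i j k l : Fin (N + 1)} (p : Chain (quiver K N).Hom i j)
    (a b : (quiver K N).Hom j k) (q : Chain (quiver K N).Hom k l) :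
    sources ((p.snoc a).append q) = sources ((p.snoc b).append q) :=
  (sources_append (p.snoc a) q).trans (sources_append (p.snoc b) q).symm

lemma length_sources {i k : Fin (N + 1)} (p : Chain (quiver K N).Hom i k) :
    (sources p).length = p.length := by
  induction p with
  | nil => rfl
  | snoc p a ih => simp [sources, Chain.length, ih]

lemma sources_eq_cons {i k : Fin (N + 1)} (p : Chain (quiver K N).Hom i k) (h : 1 ≤ p.length) :
    ∃ l, sources p = i :: l := by
  induction p with
  | nil => simp [Chain.length] at h
  | @snoc j k p a ih =>
    rcases Nat.eq_zero_or_pos p.length with h0 | h0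
    · cases p with
      | nil => exact ⟨[], rfl⟩
      | snoc p b => simp [Chain.length] at h0
    · obtain ⟨l, hl⟩ := ih h0
      exact ⟨l ++ [j], by simp only [sources, hl, List.cons_append]⟩

lemma length_sources_under {i k : Fin (N + 1)} (p : Chain (quiver K N).HomogHom i k) :
    (sources (under p)).length = p.length :=
  (length_sources _).trans (length_under p)

/-- Replacing two consecutive elements of a chain by their composition removes one vertex. -/
lemma sources_append_compHom {i k j l : Fin (N + 1)} (p : Chain (quiver K N).Hom i j)
    (t : Chain (quiver K N).Hom j l) (q : Chain (quiver K N).Hom l k) (ht : t.length = 2) :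
    sources ((p.snoc (ops t)).append q) =
      (sources ((p.append t).append q)).eraseIdx (p.length + 1) ∧
    coef ((p.snoc (ops t)).append q) = coef ((p.append t).append q) ∧
    ((p.snoc (ops t)).append q).length + 1 = ((p.append t).append q).length := by
  have h1 := sources_append (p.snoc (ops t)) q
  have h2 := sources_append (p.append t) q
  have h3 := sources_append p t
  have h4 := coef_append (p.snoc (ops t)) q
  have h5 := coef_append (p.append t) q
  have h6 := coef_append p t
  have h7 := Chain.length_append (p.snoc (ops t)) q
  have h8 := Chain.length_append (p.append t) q
  have h9 := Chain.length_append p t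
  rw [h1, h2, h3, h4, h5, h6, h7, h8, h9]
  clear h1 h2 h3 h4 h5 h6 h7 h8 h9
  cases t with
  | nil => simp [Chain.length] at ht
  | snoc t c =>
    cases t with
    | nil => simp [Chain.length] at ht
    | snoc t b =>
      cases t with
      | snoc t b => simp [Chain.length] at ht
      | nil =>
        refine ⟨?_, ?_, ?_⟩
        · simp only [sources, List.nil_append]
          rw [← length_sources p, List.append_assoc (sources p) [j],
            List.append_assoc (sources p) _ (sources q),
            List.eraseIdx_append_of_length_le (by omega)]
          simp
        · simp only [coef, ops, compHom]
          ring
        · simp only [Chain.length]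
          omega

/-- All elements of the chain have degree zero, and the vertices are weakly increasing. -/
def IsRegular {i : Fin (N + 1)} : {k : Fin (N + 1)} → Chain (quiver K N).HomogHom i k → Prop
  | _, .nil _ => True
  | k, .snoc (y := j) p a => IsRegular p ∧ a.1 = 0 ∧ j ≤ k

lemma hasZero_or_isRegular {i k : Fin (N + 1)} (p : Chain (quiver K N).HomogHom i k) :
    HasZero (under p) ∨ IsRegular p := by
  induction p with
  | nil => exact Or.inr trivial
  | @snoc j k p a ih =>
    rcases ih with h | h
    · exact Or.inl (Or.inl h)
    · by_cases ha : a.1 = 0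
      · by_cases hjk : j ≤ k
        · exact Or.inr ⟨h, ha, hjk⟩
        · exact Or.inl (Or.inr (Subtype.ext (a.2.1.2 hjk)))
      · exact Or.inl (Or.inr (eq_zero_of_mem_deg ha a.2.2))

lemma IsRegular.sdeg_eq {i k : Fin (N + 1)} {p : Chain (quiver K N).HomogHom i k}
    (h : IsRegular p) : sdeg p = -(p.length : ℤ) := by
  induction p with
  | nil => rfl
  | snoc p a ih =>
    rw [sdeg, ih h.1, h.2.1, Chain.length]
    push_cast
    ring

lemma isRegular_append {i j k : Fin (N + 1)} (p : Chain (quiver K N).HomogHom i j)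
    (q : Chain (quiver K N).HomogHom j k) : IsRegular (p.append q) ↔ IsRegular p ∧ IsRegular q := by
  induction q with
  | nil => simp [Chain.append, IsRegular]
  | snoc q a ih => simp only [Chain.append, IsRegular, ih, and_assoc]

lemma IsRegular.pairwise {i k : Fin (N + 1)} {p : Chain (quiver K N).HomogHom i k}
    (h : IsRegular p) : (sources (under p) ++ [k]).Pairwise (· ≤ ·) := by
  induction p with
  | nil => simp [under, Chain.map, sources]
  | @snoc j k p a ih =>
    have h1 := ih h.1
    refine List.pairwise_append.2 ⟨h1, List.pairwise_singleton _ _, fun b hb c hc => ?_⟩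
    obtain rfl := List.mem_singleton.1 hc
    rcases List.mem_append.1 hb with hb | hb
    · exact ((List.pairwise_append.1 h1).2.2 b hb j (List.mem_singleton.2 rfl)).trans h.2.2
    · rw [List.mem_singleton.1 hb]
      exact h.2.2

end Simplex

/-! ### Functors on simplex categories given by families of morphisms -/

namespace MappingSimplex

open Simplex

variable {K : Type u} [CommRing K] (C : UnitalAInfCat.{u, u, u} K) (x y : C.Obj) {n : ℕ}

/-- The object `y` or `x`, according to whether the argument is true or false. -/
abbrev vertexObj : Bool → C.Obj
  | false => x
  | true => y

/-- Whether a vertex of `[n + 1]` is the last one. -/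
def isLast (i : Fin (n + 2)) : Bool := decide (i = Fin.last (n + 1))

/-- The morphism with components `r • 1` between equal objects, and `v` from `x` to `y`. -/
def component : (b c : Bool) → K → C.Hom x y → C.Hom (vertexObj C x y b) (vertexObj C x y c)
  | false, false, r, _ => r • C.one x
  | true, true, r, _ => r • C.one y
  | false, true, _, v => v
  | true, false, _, _ => 0

/-- The components of the functor `[n + 1]_K → C` that is the degenerate simplex on `x` on
`{0, …, n}`, maps `n + 1` to `y`, and maps the chain of generators `i₀ → ⋯ → i_m → n + 1` to
`f [i₀, …, i_m]`. -/
def functorMap (f : List (Fin (n + 2)) → C.Hom x y) {i k : Fin (n + 2)}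
    (p : Chain (quiver K (n + 1)).Hom i k) :
    C.Hom (vertexObj C x y (isLast i)) (vertexObj C x y (isLast k)) :=
  component C x y (isLast i) (isLast k) (if p.length = 1 then coef p else 0)
    (coef p • f (sources p))

variable {C x y}

lemma isLast_last : isLast (Fin.last (n + 1)) = true := decide_eq_true rfl

lemma isLast_eq_true {i : Fin (n + 2)} : isLast i = true ↔ i = Fin.last (n + 1) :=
  decide_eq_true_iff

lemma isLast_castSucc (i : Fin (n + 1)) : isLast i.castSucc = false :=
  decide_eq_false (Fin.castSucc_lt_last i).ne

lemma component_add (b c : Bool) (r r' : K) (v v' : C.Hom x y) :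
    component C x y b c (r + r') (v + v') =
      component C x y b c r v + component C x y b c r' v' := by
  cases b <;> cases c <;> simp [component, add_smul]

lemma component_smul (b c : Bool) (t r : K) (v : C.Hom x y) :
    component C x y b c (t * r) (t • v) = t • component C x y b c r v := by
  cases b <;> cases c <;> simp [component, mul_smul]

lemma component_zero (b c : Bool) : component C x y b c 0 0 = 0 := by
  cases b <;> cases c <;> simp [component]

lemma component_congr {b c : Bool} {r r' : K} {v v' : C.Hom x y} (h : b = c → r = r')
    (h' : b = false → c = true → v = v') : component C x y b c r v = component C x y b c r' v' := by
  cases b <;> cases c <;> simp_all [component]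

lemma component_mem {b c : Bool} {r : K} {v : C.Hom x y} {d : ℤ} (h : r = 0 ∨ d = 0)
    (h' : v ∈ C.deg x y d) :
    component C x y b c r v ∈ C.deg (vertexObj C x y b) (vertexObj C x y c) d := by
  rcases h with rfl | rfl <;> cases b <;> cases c <;>
    simp [component, h', Submodule.smul_mem, C.one_mem]

/-- The family `f` is supported on the strictly increasing nonempty lists of vertices below the
last one. -/
structure IsNormalized (f : List (Fin (n + 2)) → C.Hom x y) : Prop where
  map_nil : f [] = 0
  eq_zero : ∀ l, ¬ (l ++ [Fin.last (n + 1)]).Pairwise (· < ·) → f l = 0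

/-- The conditions on `f` for `functorMap f` to be an `A_∞`-functor. -/
structure IsAdmissible (f : List (Fin (n + 2)) → C.Hom x y) : Prop extends IsNormalized f where
  mem_deg : ∀ l, f l ∈ C.deg x y (1 - l.length)
  rel : ∀ l : List (Fin (n + 2)), l.Pairwise (· ≤ ·) → Fin.last (n + 1) ∉ l →
    C.m ((Chain.nil x).snoc (f l)) +
      ∑ k ∈ Finset.range l.length, (-1 : ℤ) ^ k • f (l.eraseIdx k) = 0

variable {f : List (Fin (n + 2)) → C.Hom x y}

lemma IsNormalized.eq_zero_of_mem (hf : IsNormalized f) {l : List (Fin (n + 2))}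
    (h : Fin.last (n + 1) ∈ l) : f l = 0 := by
  refine hf.eq_zero l fun h' => ?_
  exact lt_irrefl _ ((List.pairwise_append.1 h').2.2 _ h _ (List.mem_singleton.2 rfl))

lemma length_append_snoc {i j k l : Fin (n + 2)} (p : Chain (quiver K (n + 1)).Hom i j)
    (a : (quiver K (n + 1)).Hom j k) (q : Chain (quiver K (n + 1)).Hom k l) :
    ((p.snoc a).append q).length = p.length + 1 + q.length := by
  rw [Chain.length_append, Chain.length]

variable (f) in
lemma functorMap_multilinear : IsMultilinear (quiver K (n + 1))
    (N := fun i k => C.Hom (vertexObj C x y (isLast i)) (vertexObj C x y (isLast k)))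
    (functorMap C x y f) where
  map_add {i j k l} p a b q := by
    have h1 := length_append_snoc (K := K) p (a + b) q
    have h2 := length_append_snoc (K := K) p a q
    have h3 := length_append_snoc (K := K) p b q
    have e1 := sources_append_congr p (a + b) a q
    have e2 := sources_append_congr p b a q
    simp only [functorMap]
    rw [← component_add, h1, h2, h3, e1, e2, coef_append_add, add_smul]
    congr 1
    split_ifs <;> simp
  map_smul {i j k l} p c a q := by
    have h1 := length_append_snoc (K := K) p (c • a) q
    have h2 := length_append_snoc (K := K) p a q
    have e1 := sources_append_congr p (c • a) a q
    simp only [functorMap]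
    rw [← component_smul, h1, h2, e1, coef_append_smul, mul_smul]
    congr 1
    split_ifs <;> simp

lemma functorMap_deg (hf : IsAdmissible f) {i k : Fin (n + 2)}
    (p : Chain (quiver K (n + 1)).HomogHom i k) :
    functorMap C x y f (under p) ∈
      C.deg (vertexObj C x y (isLast i)) (vertexObj C x y (isLast k)) (sdeg p + 1) := by
  rcases hasZero_or_isRegular p with h | h
  · rw [(functorMap_multilinear f).eq_zero_of_hasZero _ h]
    exact Submodule.zero_mem _
  · have hd := h.sdeg_eq
    refine component_mem ?_ (Submodule.smul_mem _ _ ?_)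
    · by_cases h1 : (under p).length = 1
      · right
        have h2 := (length_under p).symm.trans h1
        rw [hd, h2]
        rfl
      · exact Or.inl (if_neg h1)
    · have := hf.mem_deg (sources (under p))
      rw [length_sources_under] at this
      rw [hd, neg_add_eq_sub]
      exact this

/-- The components vanish on chains of length at least two that end in a morphism which is not
from `{0, …, n}` to `n + 1`. -/
lemma functorMap_snoc_eq_zero (hf : IsNormalized f) {i j k : Fin (n + 2)}
    (p : Chain (quiver K (n + 1)).Hom i j) (a : (quiver K (n + 1)).Hom j k)
    (hjk : isLast j = isLast k) (hp : 1 ≤ p.length) : functorMap C x y f (p.snoc a) = 0 := by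
  rw [functorMap, ← component_zero]
  refine component_congr (fun _ => if_neg (by simp only [Chain.length]; omega)) fun _ hk => ?_
  have hj := isLast_eq_true.1 (hjk.trans hk)
  rw [hf.eq_zero_of_mem (by simp [sources, hj]), smul_zero]

lemma functorMap_append_eq_zero (hf : IsNormalized f) {i j k : Fin (n + 2)}
    (p : Chain (quiver K (n + 1)).Hom i j) (a : (quiver K (n + 1)).Hom j j)
    (q : Chain (quiver K (n + 1)).Hom j k) (h : 2 ≤ p.length + 1 + q.length) :
    functorMap C x y f ((p.snoc a).append q) = 0 := by
  rcases Nat.eq_zero_or_pos q.length with h0 | h0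
  · cases q with
    | nil => exact functorMap_snoc_eq_zero hf p a rfl (by simp only [Chain.length] at h; omega)
    | snoc q b => simp [Chain.length] at h0
  · rw [functorMap, ← component_zero]
    refine component_congr (fun _ => if_neg ?_) fun _ _ => ?_
    · rw [Chain.length_append]
      simp only [Chain.length]
      omega
    · obtain ⟨l, hl⟩ := sources_eq_cons q h0
      rw [hf.eq_zero, smul_zero]
      rw [sources_append, hl]
      simp [sources, List.pairwise_append]

/-- The right hand side of the functor equations for `functorMap f`. -/
lemma barSum_functorMap {i k : Fin (n + 2)} (p : Chain (quiver K (n + 1)).HomogHom i k)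
    (hp : IsRegular p) :
    barSum (G := quiver K (n + 1))
      (N := fun i k => C.Hom (vertexObj C x y (isLast i)) (vertexObj C x y (isLast k)))
      ops (functorMap C x y f) p =
    ∑ j ∈ Finset.range (p.length - 1), (-1 : ℤ) ^ j • component C x y (isLast i) (isLast k)
      (if p.length = 2 then coef (under p) else 0)
      (coef (under p) • f ((sources (under p)).eraseIdx (j + 1))) := by
  set g : ℕ → C.Hom (vertexObj C x y (isLast i)) (vertexObj C x y (isLast k)) := fun j =>
    (-1 : ℤ) ^ j • component C x y (isLast i) (isLast k)
      (if p.length = 2 then coef (under p) else 0)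
      (coef (under p) • f ((sources (under p)).eraseIdx (j + 1))) with hg
  have hinner : ∀ s ∈ p.splits, (sdeg s.2.1).negOnePow • (s.2.2.splits.map fun t =>
      functorMap C x y f (((under s.2.1).snoc (ops (under t.2.1))).append (under t.2.2))).sum =
      if s.2.1.length < p.length - 1 then g s.2.1.length else 0 := by
    intro s hs
    have hlen := length_of_splits hs
    have hps := Chain.append_of_splits p s hs
    have hs1 : IsRegular s.2.1 := ((isRegular_append _ _).1 (hps.symm ▸ hp)).1
    have hsign : ∀ v : C.Hom (vertexObj C x y (isLast i)) (vertexObj C x y (isLast k)),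
        (sdeg s.2.1).negOnePow • v = (-1 : ℤ) ^ s.2.1.length • v := by
      intro v
      rw [hs1.sdeg_eq, Int.negOnePow_neg, Units.smul_def]
      simp [Int.negOnePow]
    have hterm : ∀ t ∈ s.2.2.splits,
        functorMap C x y f (((under s.2.1).snoc (ops (under t.2.1))).append (under t.2.2)) =
        if t.2.1.length = 2 then component C x y (isLast i) (isLast k)
          (if p.length = 2 then coef (under p) else 0)
          (coef (under p) • f ((sources (under p)).eraseIdx (s.2.1.length + 1))) else 0 := by
      intro t ht
      have hlen' := length_of_splits ht
      have hst := Chain.append_of_splits _ t ht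
      by_cases h2 : t.2.1.length = 2
      · rw [if_pos h2]
        obtain ⟨e1, e2, e3⟩ := sources_append_compHom (under s.2.1) (under t.2.1) (under t.2.2)
          ((length_under t.2.1).trans h2)
        have e4 : ((under s.2.1).append (under t.2.1)).append (under t.2.2) = under p :=
          (Chain.append_assoc _ _ _).trans ((congrArg (Chain.append (under s.2.1))
            ((under_append t.2.1 t.2.2).symm.trans (congrArg under hst))).trans
              ((under_append s.2.1 s.2.2).symm.trans (congrArg under hps)))
        have e5 := length_under s.2.1
        have e6 := length_under p
        rw [e4] at e1 e2 e3
        rw [e5] at e1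
        rw [functorMap, e1, e2]
        refine component_congr (fun _ => ?_) fun _ _ => rfl
        congr 1
        rw [eq_iff_iff]
        omega
      · rw [if_neg h2]
        have h3 : ops (under t.2.1) = 0 := ops_eq_zero _ fun h => h2 ((length_under _).symm.trans h)
        refine Eq.trans ?_ ((functorMap_multilinear f).map_zero (y := s.1) (z := t.1)
          (under s.2.1) (under t.2.2))
        exact congrArg (fun e => functorMap C x y f
          ((Chain.snoc (under s.2.1) e).append (under t.2.2))) h3
    rw [List.map_congr_left hterm, hsign]
    rw [Chain.sum_splits_eq_range s.2.2 (fun j => if j = 2 then _ else 0),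
      Finset.sum_ite_eq' (Finset.range _) 2]
    have : 2 ∈ Finset.range (s.2.2.length + 1) ↔ s.2.1.length < p.length - 1 := by
      rw [Finset.mem_range]; omega
    simp only [this, hg]
    split_ifs <;> simp
  rw [barSum, List.map_congr_left hinner, Chain.sum_splits_eq_range p
    (fun j => if j < p.length - 1 then g j else 0), ← Finset.sum_filter]
  refine Finset.sum_congr ?_ fun _ _ => rfl
  ext j
  simp only [Finset.mem_filter, Finset.mem_range]
  omega

end MappingSimplex

namespace MappingSimplex

open Simplex

variable {K : Type u} [CommRing K] {C : UnitalAInfCat.{u, u, u} K} {x y : C.Obj} {n : ℕ}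

/-! ### The functor equations -/

lemma m_component_eq_zero {b c : Bool} (h : b = c) (r : K) (v : C.Hom x y) :
    C.m ((Chain.nil _).snoc (component C x y b c r v)) = 0 := by
  subst h
  have h1 : ∀ z : C.Obj, C.m ((Chain.nil z).snoc (r • C.one z)) = 0 := fun z =>
    (C.m_multilinear.map_smul (Chain.nil z) r (C.one z) (Chain.nil z)).trans
      (by rw [Chain.append, C.m_single_one, smul_zero])
  cases b
  · exact h1 x
  · exact h1 y

lemma m_component {b c : Bool} (hb : b = false) (hc : c = true) (r : K) (v : C.Hom x y) :
    C.m ((Chain.nil _).snoc (component C x y b c r v)) =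
      component C x y b c 0 (C.m ((Chain.nil _).snoc v)) := by
  subst hb hc
  rfl

/-- The operations `m^r` with `r ≥ 3` vanish on multiples of units. -/
lemma m_append_component_eq_zero {b c : Bool} (h : b = c) {z t : C.Obj}
    (p : Chain C.Hom z (vertexObj C x y b)) (q : Chain C.Hom (vertexObj C x y c) t)
    (hpq : 2 ≤ p.length + q.length) (r : K) (v : C.Hom x y) :
    C.m ((p.snoc (component C x y b c r v)).append q) = 0 := by
  subst h
  have h1 : ∀ (z' : C.Obj) (p : Chain C.Hom z z') (q : Chain C.Hom z' t),
      2 ≤ p.length + q.length → C.m ((p.snoc (r • C.one z')).append q) = 0 :=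
    fun z' p q hpq => (C.m_multilinear.map_smul p r (C.one z') q).trans
      (by rw [C.m_one p q (by omega), smul_zero])
  cases b
  · exact h1 x p q hpq
  · exact h1 y p q hpq

lemma m_component_left {b b' c : Bool} (h : b' = c) {r r' : K} {v v' : C.Hom x y} {d : ℤ}
    (hd : component C x y b b' r v ∈ C.deg (vertexObj C x y b) (vertexObj C x y b') d) :
    C.m (((Chain.nil _).snoc (component C x y b b' r v)).snoc (component C x y b' c r' v')) =
      r' • d.negOnePow • component C x y b c r v := by
  subst h
  have h1 : ∀ (z z' : C.Obj) (g : C.Hom z z'), g ∈ C.deg z z' d →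
      C.m (((Chain.nil _).snoc g).snoc (r' • C.one z')) = r' • d.negOnePow • g :=
    fun z z' g hg => (C.m_multilinear.map_smul ((Chain.nil z).snoc g) r' (C.one z')
      (Chain.nil z')).trans (by rw [Chain.append, C.m_one_left d g hg])
  have := h1 _ _ _ hd
  cases b'
  · exact this
  · exact this

lemma m_component_right {b b' c : Bool} (hb : b = false) (hb' : b' = false) (hc : c = true)
    (r r' : K) (v v' : C.Hom x y) :
    C.m (((Chain.nil _).snoc (component C x y b b' r v)).snoc (component C x y b' c r' v')) =
      component C x y b c 0 (r • v') := by
  subst hb hb' hc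
  refine (C.m_multilinear.map_smul (Chain.nil x) r (C.one x) ((Chain.nil x).snoc v')).trans ?_
  exact congrArg (r • ·) (C.m_one_right v')

variable {f : List (Fin (n + 2)) → C.Hom x y}

/-- The left hand side of the functor equations for chains that end in a morphism between two
vertices with the same image. -/
lemma sum_blocksAux_same (hf : IsNormalized f) {i j k : Fin (n + 2)}
    (p : Chain (quiver K (n + 1)).Hom i j) (a : (quiver K (n + 1)).Hom j k)
    (hjk : isLast j = isLast k) (hp : 1 ≤ p.length) :
    ((Chain.blocksAux (H' := C.Hom) (o := fun i => vertexObj C x y (isLast i))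
      (functorMap C x y f) p ((Chain.nil _).snoc a)).map fun c => C.m c).sum =
    C.m (((Chain.nil _).snoc (functorMap C x y f p)).snoc
      (functorMap C x y f ((Chain.nil _).snoc a))) := by
  cases p with
  | nil => simp [Chain.length] at hp
  | @snoc j' _ p b =>
    simp only [Chain.blocksAux, List.map_append, List.sum_append, List.map_map, Function.comp_def]
    have hz : ∀ c : Chain C.Hom (vertexObj C x y (isLast i)) (vertexObj C x y (isLast j)),
        2 ≤ c.length → C.m (c.snoc (functorMap C x y f ((Chain.nil _).snoc a))) = 0 := fun c hc =>
      m_append_component_eq_zero hjk c (Chain.nil _) (by simpa [Chain.length] using hc) _ _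
    have h1 := Chain.sum_blocksAux_eq_single (H' := C.Hom)
      (o := fun i => vertexObj C x y (isLast i)) (functorMap C x y f) p ((Chain.nil _).snoc b)
      (fun c => C.m (c.snoc (functorMap C x y f ((Chain.nil _).snoc a))))
      (fun c hc => hz c hc)
    rw [h1, List.sum_eq_zero, add_zero]
    · rfl
    · intro v hv
      simp only [List.mem_map] at hv
      obtain ⟨c, hc, rfl⟩ := hv
      refine C.m_multilinear.eq_zero_of_hasZero c ?_
      refine hasZero_of_mem_blocksAux_of_forall_append (G := quiver K (n + 1))
        (G' := C.toGradedQuiver) (φ := functorMap C x y f) _ _ (fun q => ?_) c hc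
      exact functorMap_snoc_eq_zero hf (q.snoc b) a hjk (by simp [Chain.length])

/-- The left hand side of the functor equations for chains from `{0, …, n}` to `n + 1`. -/
lemma sum_blocksAux_last (hf : IsNormalized f) {i j : Fin (n + 2)}
    (p : Chain (quiver K (n + 1)).Hom i j)
    (s : Chain (quiver K (n + 1)).Hom j (Fin.last (n + 1)))
    (hp : Fin.last (n + 1) ∉ sources p) (hj : isLast j = false) :
    ((Chain.blocksAux (H' := C.Hom) (o := fun i => vertexObj C x y (isLast i))
      (functorMap C x y f) p s).map fun c => C.m c).sum =
    component C x y (isLast i) (isLast (Fin.last (n + 1))) 0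
      (C.m ((Chain.nil x).snoc (coef (p.append s) • f (sources (p.append s)))) +
        if p.length = 0 then 0 else coef (p.append s) • f (sources (p.append s)).tail) := by
  induction p with
  | nil =>
    rw [if_pos (by rfl), add_zero, Chain.nil_append]
    simp only [Chain.blocksAux, List.map_cons, List.map_nil, List.sum_cons, List.sum_nil, add_zero]
    exact m_component hj isLast_last _ _
  | @snoc j' j p a ih =>
    have hj' : isLast j' = false := by
      rw [← Bool.not_eq_true, isLast_eq_true]
      rintro rfl
      exact hp (by simp [sources])
    have hp' : Fin.last (n + 1) ∉ sources p := fun h => hp (by simp [sources, h])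
    simp only [Chain.blocksAux, List.map_append, List.sum_append, List.map_map, Function.comp_def]
    have h2 := ih (((Chain.nil _).snoc a).append s) hp' hj'
    rw [h2, ← Chain.append_assoc]
    cases p with
    | nil =>
      simp only [Chain.blocksAux, List.map_cons, List.map_nil, List.sum_cons, List.sum_nil,
        add_zero]
      have h3 := m_component_right (C := C) (x := x) (y := y) hj' hj (isLast_last (n := n))
        (if Chain.length ((Chain.nil _).snoc a) = 1 then coef ((Chain.nil _).snoc a) else 0)
        (if Chain.length s = 1 then coef s else 0)
        (coef ((Chain.nil _).snoc a) • f (sources ((Chain.nil _).snoc a)))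
        (coef s • f (sources s))
      refine (congrArg (· + _) h3).trans ?_
      rw [← component_add, add_zero]
      refine component_congr (fun _ => rfl) fun _ _ => ?_
      have e1 : coef ((Chain.nil i).snoc a) = a.1 := one_mul _
      have e2 : coef (((Chain.nil i).snoc a).append s) = a.1 * coef s :=
        (coef_append _ s).trans (congrArg (· * coef s) e1)
      have e3 : sources (((Chain.nil i).snoc a).append s) = i :: sources s := sources_append _ s
      rw [if_pos (by rfl), if_pos (by rfl), if_neg (by simp [Chain.length]), e1, e2, e3,
        add_zero, add_comm, List.tail_cons]
      change C.m ((Chain.nil x).snoc (coef (((Chain.nil i).snoc a).append s) •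
        f (sources (((Chain.nil i).snoc a).append s)))) + _ = _
      rw [e2, e3, mul_smul a.1 _ (f (sources s))]
    | @snoc j'' _ p b =>
      rw [List.sum_eq_zero, zero_add]
      · rw [if_neg (by simp [Chain.length]), if_neg (by simp [Chain.length])]
        rfl
      · intro v hv
        simp only [List.mem_map] at hv
        obtain ⟨c, hc, rfl⟩ := hv
        simp only [Chain.blocksAux, List.mem_append, List.mem_map] at hc
        rcases hc with ⟨c, hc, rfl⟩ | hc
        -- the second to last block is one multiple of a unit among at least three blocks
        · refine m_append_component_eq_zero (hj'.trans hj.symm) c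
            ((Chain.nil _).snoc (functorMap C x y f s)) ?_ _ _
          have := Chain.mem_blocksAux_length (H' := C.Hom)
            (o := fun i => vertexObj C x y (isLast i)) (functorMap C x y f) p _ c hc
          simp only [Chain.length]
          omega
        -- the second to last block has length at least two
        · refine C.m_multilinear.eq_zero_of_hasZero _ (Or.inl ?_)
          refine hasZero_of_mem_blocksAux_of_forall_append (G := quiver K (n + 1))
            (G' := C.toGradedQuiver) (φ := functorMap C x y f) _ _ (fun q => ?_) c hc
          exact functorMap_snoc_eq_zero hf (q.snoc b) a (hj'.trans hj.symm) (by simp [Chain.length])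

lemma component_sub_sum {b c : Bool} (hb : b = false) (hc : c = true) (v : C.Hom x y)
    (s : Finset ℕ) (r : K) (w : ℕ → C.Hom x y) :
    component C x y b c 0 v - ∑ j ∈ s, (-1 : ℤ) ^ j • component C x y b c r (w j) =
      component C x y b c 0 (v - ∑ j ∈ s, (-1 : ℤ) ^ j • w j) := by
  subst hb hc
  rfl

lemma le_of_mem_sources {i j : Fin (n + 2)} {p : Chain (quiver K (n + 1)).HomogHom i j}
    (hp : IsRegular p) {l : Fin (n + 2)} (h : l ∈ sources (under p)) : l ≤ j :=
  (List.pairwise_append.1 hp.pairwise).2.2 l h j (List.mem_singleton.2 rfl)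

lemma last_notMem_sources {i j : Fin (n + 2)} {p : Chain (quiver K (n + 1)).HomogHom i j}
    (hp : IsRegular p) (hj : isLast j = false) : Fin.last (n + 1) ∉ sources (under p) := by
  intro h
  have := Fin.last_le_iff.1 (le_of_mem_sources hp h)
  rw [this, isLast_last] at hj
  exact Bool.noConfusion hj

lemma isLast_source {i j : Fin (n + 2)} {p : Chain (quiver K (n + 1)).HomogHom i j}
    (hp : IsRegular p) (hj : isLast j = false) : isLast i = false := by
  rcases Nat.eq_zero_or_pos p.length with h | h
  · cases p with
    | nil => exact hj
    | snoc p a => simp [Chain.length] at h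
  · rw [← Bool.not_eq_true, isLast_eq_true]
    rintro rfl
    obtain ⟨l, hl⟩ := sources_eq_cons (under p) (h.trans_eq (length_under p).symm)
    exact last_notMem_sources hp hj (hl ▸ List.mem_cons_self)

/-- On chains from `{0, …, n}` to `n + 1`, the functor equation for `functorMap f` is the equation
in `IsAdmissible`. -/
lemma functorMap_rel_last (hf : IsNormalized f) {i j : Fin (n + 2)}
    (p : Chain (quiver K (n + 1)).HomogHom i j)
    (a : (quiver K (n + 1)).HomogHom j (Fin.last (n + 1))) (hp : IsRegular (p.snoc a))
    (hj : isLast j = false) :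
    ((Chain.blocks (H' := C.Hom) (o := fun i => vertexObj C x y (isLast i))
      (functorMap C x y f) (under (p.snoc a))).map fun c => C.m c).sum -
    barSum (G := quiver K (n + 1))
      (N := fun i k => C.Hom (vertexObj C x y (isLast i)) (vertexObj C x y (isLast k)))
      ops (functorMap C x y f) (p.snoc a) =
    component C x y (isLast i) (isLast (Fin.last (n + 1))) 0
      (C.m ((Chain.nil x).snoc (coef (under (p.snoc a)) • f (sources (under (p.snoc a))))) +
        coef (under (p.snoc a)) • ∑ k ∈ Finset.range (sources (under (p.snoc a))).length,
          (-1 : ℤ) ^ k • f ((sources (under (p.snoc a))).eraseIdx k)) := by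
  have h1 := sum_blocksAux_last hf (under p) ((Chain.nil j).snoc a.2.1)
    (last_notMem_sources hp.1 hj) hj
  have h2 := barSum_functorMap (C := C) (x := x) (y := y) (f := f) (p.snoc a) hp
  refine (congrArg₂ (· - ·) h1 h2).trans ?_
  rw [component_sub_sum (isLast_source hp.1 hj) isLast_last]
  congr 1
  have h3 : (under p).append ((Chain.nil j).snoc a.2.1) = under (p.snoc a) := rfl
  have h4 := length_sources_under (p.snoc a)
  have h5 := length_under p
  rw [h3, add_sub_assoc, h4, h5]
  congr 1
  rw [Chain.length, Finset.sum_range_succ', smul_add, Finset.smul_sum, Nat.add_sub_cancel,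
    sub_eq_add_neg, add_comm, ← Finset.sum_neg_distrib]
  congr 1
  · refine Finset.sum_congr rfl fun k _ => ?_
    rw [pow_succ, mul_neg_one, neg_smul, smul_neg, smul_comm]
  · split_ifs with h
    · cases p with
      | nil => simp [under, Chain.map, sources, hf.map_nil]
      | snoc p b => simp [Chain.length] at h
    · simp

lemma functorMap_rel (hf : IsAdmissible f) {i k : Fin (n + 2)}
    (p : Chain (quiver K (n + 1)).HomogHom i k) :
    ((Chain.blocks (H' := C.Hom) (o := fun i => vertexObj C x y (isLast i))
      (functorMap C x y f) (under p)).map fun c => C.m c).sum =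
    barSum (G := quiver K (n + 1))
      (N := fun i k => C.Hom (vertexObj C x y (isLast i)) (vertexObj C x y (isLast k)))
      ops (functorMap C x y f) p := by
  rcases hasZero_or_isRegular p with h | h
  · rw [barSum_eq_zero_of_hasZero (ops_multilinear _) (functorMap_multilinear f) p h]
    cases p with
    | nil => exact h.elim
    | @snoc j _ p a =>
      refine List.sum_eq_zero fun v hv => ?_
      simp only [List.mem_map] at hv
      obtain ⟨c, hc, rfl⟩ := hv
      refine C.m_multilinear.eq_zero_of_hasZero c ?_
      exact hasZero_of_mem_blocksAux (G := quiver K (n + 1)) (G' := C.toGradedQuiver)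
        (functorMap_multilinear f) (under p) ((Chain.nil j).snoc a.2.1)
        (h.imp_right fun h => Or.inr h) c hc
  cases p with
  | nil =>
    rw [barSum_functorMap _ h]
    simp [under, Chain.map, Chain.blocks, Chain.length, C.m_nil]
  | @snoc j _ p a =>
    by_cases hjk : isLast j = isLast k
    · rw [barSum_functorMap _ h]
      rcases Nat.eq_zero_or_pos p.length with h0 | h0
      · cases p with
        | nil =>
          simp only [under, Chain.map, Chain.blocks, Chain.blocksAux, List.map_cons, List.map_nil,
            List.sum_cons, List.sum_nil, Chain.length, zero_add, Nat.sub_self, Finset.range_zero,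
            Finset.sum_empty, add_zero]
          exact m_component_eq_zero hjk _ _
        | snoc p b => simp [Chain.length] at h0
      · have h1 := sum_blocksAux_same hf.toIsNormalized (under p) a.2.1 hjk
          (h0.trans_eq (length_under p).symm)
        have h2 := m_component_left (C := C) (x := x) (y := y) hjk (functorMap_deg hf p)
          (r' := if Chain.length ((Chain.nil j).snoc a.2.1) = 1 then
            coef ((Chain.nil j).snoc a.2.1) else 0)
          (v' := coef ((Chain.nil j).snoc a.2.1) • f (sources ((Chain.nil j).snoc a.2.1)))
        refine (h1.trans h2).trans ?_
        have e1 : coef ((Chain.nil j).snoc a.2.1) = a.2.1.1 := one_mul _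
        have e2 : coef (under (p.snoc a)) = coef (under p) * a.2.1.1 := rfl
        have e3 : sources (under (p.snoc a)) = sources (under p) ++ [j] := rfl
        have e4 := length_under p
        have e5 := length_sources_under p
        have e6 : (sdeg p + 1).negOnePow = (-1 : ℤˣ) ^ (p.length - 1) := by
          rw [h.1.sdeg_eq, ← Int.negOnePow_neg, ← zpow_natCast]
          congr 1
          omega
        rw [if_pos (by rfl), e1, e2, e3, e4, e6]
        rw [Finset.sum_eq_single (p.length - 1)]
        · rw [Units.smul_def, Units.val_pow_eq_pow_val, Units.val_neg, Units.val_one, smul_comm,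
            ← component_smul, ← smul_assoc, smul_eq_mul, mul_comm a.2.1.1]
          congr 2
          · have e7 : (p.snoc a).length = p.length + 1 := rfl
            by_cases h1 : p.length = 1
            · exact (congrArg (· * a.2.1.1) (if_pos h1)).trans (if_pos (by omega)).symm
            · exact ((congrArg (· * a.2.1.1) (if_neg h1)).trans (zero_mul _)).trans
                (if_neg (by omega)).symm
          · rw [List.eraseIdx_append_of_length_le (by omega)]
            simp [e5, show p.length - 1 + 1 - p.length = 0 by omega, mul_comm]
        · intro l hl hl'
          simp only [Chain.length, Finset.mem_range] at hl ⊢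
          refine (congrArg ((-1 : ℤ) ^ l • ·) ?_).trans (smul_zero _)
          rw [← component_zero (isLast i) (isLast k)]
          refine component_congr (fun _ => if_neg (by omega)) fun _ hk => ?_
          have hj := isLast_eq_true.1 (hjk.trans hk)
          rw [hf.eq_zero_of_mem, smul_zero]
          rw [List.eraseIdx_append_of_lt_length (by omega)]
          simp [hj]
        · intro hl
          simp only [Chain.length, Finset.mem_range] at hl
          omega
    · have hj : isLast j = false := by
        rw [← Bool.not_eq_true, isLast_eq_true]
        rintro rfl
        exact hjk (congrArg isLast (Fin.last_le_iff.1 h.2.2).symm)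
      have hk : k = Fin.last (n + 1) := by
        rw [← isLast_eq_true, ← Bool.not_eq_false]
        exact fun hk => hjk (hj.trans hk.symm)
      subst hk
      have h1 := functorMap_rel_last hf.toIsNormalized p a h hj
      refine sub_eq_zero.1 (h1.trans ?_)
      rw [← component_zero]
      congr 1
      have h2 := hf.rel (sources (under (p.snoc a))) (List.pairwise_append.1 h.pairwise).1 (by
        have := last_notMem_sources h.1 hj
        have hj' : Fin.last (n + 1) ≠ j := by
          rintro rfl
          rw [isLast_last] at hj
          exact Bool.noConfusion hj
        change _ ∉ sources (under p) ++ [j]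
        simp [this, hj'])
      have h3 : C.m ((Chain.nil x).snoc (coef (under (p.snoc a)) •
          f (sources (under (p.snoc a))))) = coef (under (p.snoc a)) •
          C.m ((Chain.nil x).snoc (f (sources (under (p.snoc a))))) :=
        C.m_multilinear.map_smul (Chain.nil x) _ _ (Chain.nil y)
      rw [h3, ← smul_add, h2, smul_zero]

lemma functorMap_nil (f : List (Fin (n + 2)) → C.Hom x y) (i : Fin (n + 2)) :
    functorMap C x y f (Chain.nil i : Chain (quiver K (n + 1)).Hom i i) = 0 := by
  rw [functorMap, ← component_zero]
  exact component_congr (fun _ => rfl) fun h h' => Bool.noConfusion (h.symm.trans h')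

lemma functorMap_one (f : List (Fin (n + 2)) → C.Hom x y) (i : Fin (n + 2)) :
    functorMap C x y f ((Chain.nil i).snoc ((cat K (n + 1)).one i)) =
      C.one (vertexObj C x y (isLast i)) := by
  have h : ∀ (b : Bool) (v : C.Hom x y), component C x y b b 1 v = C.one (vertexObj C x y b) := by
    intro b v
    cases b <;> exact one_smul K _
  refine Eq.trans ?_ (h (isLast i) 0)
  exact component_congr (fun _ => one_mul (1 : K)) fun h h' => Bool.noConfusion (h.symm.trans h')

/-- The `A_∞`-functor with components `functorMap f`. -/
def toAInfFunctor (f : List (Fin (n + 2)) → C.Hom x y) (hf : IsAdmissible f) :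
    AInfFunctor (cat K (n + 1)) C where
  obj i := vertexObj C x y (isLast i)
  map := functorMap C x y f
  map_nil := functorMap_nil f
  map_multilinear := functorMap_multilinear f
  map_deg := functorMap_deg hf
  map_rel := functorMap_rel hf
  map_one := functorMap_one f
  map_one_eq_zero p q h := functorMap_append_eq_zero hf.toIsNormalized p _ q h

end MappingSimplex

/-! ### The simplices of the right mapping space given by families of morphisms -/

lemma AInfFunctor.ext_of_heq {K : Type u} [CommRing K] {A : UnitalAInfCat.{u, v, w} K}
    {B : UnitalAInfCat.{u, u, u} K} {F G : AInfFunctor A B} (h : ∀ i, F.obj i = G.obj i)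
    (h' : ∀ {i k : A.Obj} (p : Chain A.Hom i k), HEq (F.map p) (G.map p)) : F = G := by
  obtain ⟨o, f, h1, h2, h3, h4, h5, h6⟩ := F
  obtain ⟨o', f', h1', h2', h3', h4', h5', h6'⟩ := G
  obtain rfl : o = o' := funext h
  obtain rfl : @f = @f' := by
    funext i k p
    exact eq_of_heq (h' p)
  rfl

namespace Simplex

variable {K : Type u} [CommRing K] {m n : ℕ}

lemma coef_mapChain (α : Fin (m + 1) →o Fin (n + 1)) {i k : Fin (m + 1)}
    (p : Chain (quiver K m).Hom i k) : coef ((functor α).mapChain p) = coef p := by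
  induction p with
  | nil => rfl
  | snoc p a ih => exact congrArg (· * a.1) ih

lemma sources_mapChain (α : Fin (m + 1) →o Fin (n + 1)) {i k : Fin (m + 1)}
    (p : Chain (quiver K m).Hom i k) :
    sources ((functor α).mapChain p) = (sources p).map α := by
  induction p with
  | nil => rfl
  | snoc p a ih =>
    rw [sources, List.map_append, ← ih]
    rfl

lemma point_onChain {C : UnitalAInfCat.{u, u, u} K} (x : C.Obj) {i k : Fin 1}
    (p : Chain (quiver K 0).Hom i k) :
    (C.point x).onChain p = (if p.length = 1 then coef p else 0) • C.one x := by
  match p with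
  | .nil _ => exact (zero_smul _ _).symm
  | .snoc (.nil _) a => exact congrArg (· • C.one x) (one_mul a.1).symm
  | .snoc (.snoc p a) b =>
    rw [if_neg (by simp only [Chain.length]; omega), zero_smul]
    rfl

end Simplex

namespace MappingSimplex

open Simplex

variable {K : Type u} [CommRing K] {C : UnitalAInfCat.{u, u, u} K} {x y : C.Obj} {m n : ℕ}

lemma component_heq {b c b' c' : Bool} (hb : b = b') (hc : c = c') (r : K) (v : C.Hom x y) :
    HEq (component C x y b c r v) (component C x y b' c' r v) := by
  subst hb hc
  rfl

variable {f : List (Fin (n + 2)) → C.Hom x y}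

/-- The restriction to vertices with the same image (`x` if `b` is false, `y` if `b` is true) is a
degenerate simplex. The map `β` is unique; it is a parameter since the unique map is written in
different ways in `SSet.homR`. -/
lemma precomp_toAInfFunctor_eq_point (hf : IsAdmissible f) (b : Bool)
    (α : Fin (m + 1) →o Fin (n + 2)) (hα : ∀ i, isLast (α i) = b) (β : Fin (m + 1) →o Fin 1) :
    (functor α).precomp (toAInfFunctor f hf) =
      (functor β).precomp (C.point (vertexObj C x y b)).toAInfFunctor := by
  refine AInfFunctor.ext_of_heq (fun i => congrArg (vertexObj C x y) (hα i)) fun {i k} p => ?_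
  refine (component_heq (hα i) (hα k) _ _).trans (heq_of_eq ?_)
  refine Eq.trans ?_ (point_onChain _ _).symm
  have h1 := (functor (K := K) α).length_mapChain p
  have h2 := (functor (K := K) β).length_mapChain p
  rw [h1, h2, coef_mapChain, coef_mapChain]
  cases b <;> rfl

lemma isLast_extendLast (α : SimplexCategory.mk m ⟶ SimplexCategory.mk n) (i : Fin (m + 2)) :
    isLast ((SSet.extendLast α).toOrderHom i) = isLast i := by
  induction i using Fin.lastCases with
  | last => rw [SSet.extendLast_last, isLast_last, isLast_last]
  | cast i => rw [SSet.extendLast_castSucc, isLast_castSucc, isLast_castSucc]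

lemma precomp_extendLast_toAInfFunctor (hf : IsAdmissible f)
    (α : SimplexCategory.mk m ⟶ SimplexCategory.mk n) {f' : List (Fin (m + 2)) → C.Hom x y}
    (hf' : IsAdmissible f') (h : ∀ l, f' l = f (l.map (SSet.extendLast α).toOrderHom)) :
    (functor (SSet.extendLast α).toOrderHom).precomp (toAInfFunctor f hf) =
      toAInfFunctor f' hf' := by
  refine AInfFunctor.ext_of_heq
    (fun i => congrArg (vertexObj C x y) (isLast_extendLast α i)) fun {i k} p => ?_
  refine (component_heq (isLast_extendLast α i) (isLast_extendLast α k) _ _).trans (heq_of_eq ?_)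
  have h1 := (functor (K := K) (SSet.extendLast α).toOrderHom).length_mapChain p
  rw [h1, coef_mapChain, sources_mapChain]
  exact congrArg (fun v => component C x y (isLast i) (isLast k)
    (if p.length = 1 then coef p else 0) (coef p • v)) (h (sources p)).symm

/-- The `n`-simplex of the right mapping space given by an admissible family of morphisms. -/
def simplex (f : List (Fin (n + 2)) → C.Hom x y) (hf : IsAdmissible f) :
    (aInfNerve.homR C x y).obj (op (.mk n)) :=
  ⟨toAInfFunctor f hf, by
    refine (precomp_toAInfFunctor_eq_point hf true _ (fun _ => isLast_last) OrderHom.id).trans ?_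
    exact precomp_id _, by
    refine precomp_toAInfFunctor_eq_point hf false _ (fun i => ?_) _
    exact (congrArg isLast (Fin.succAbove_last_apply i)).trans (isLast_castSucc i)⟩

lemma component_simplex (hf : IsAdmissible f) (i : Fin (n + 1))
    (p : Chain (cat K (n + 1)).Hom i.castSucc (Fin.last (n + 1))) :
    aInfNerve.component (simplex f hf) i p = coef p • f (sources p) :=
  eq_of_heq ((cast_heq _ _).trans
    (component_heq (isLast_castSucc i) isLast_last (if p.length = 1 then coef p else 0)
      (coef p • f (sources p))))

lemma map_simplex (hf : IsAdmissible f) (α : SimplexCategory.mk m ⟶ SimplexCategory.mk n)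
    {f' : List (Fin (m + 2)) → C.Hom x y} (hf' : IsAdmissible f')
    (h : ∀ l, f' l = f (l.map (SSet.extendLast α).toOrderHom)) :
    (aInfNerve.homR C x y).map α.op (simplex f hf) = simplex f' hf' :=
  Subtype.ext (precomp_extendLast_toAInfFunctor hf α hf' h)

end MappingSimplex

/-! ### Admissible families and normalized chain maps -/

lemma UnitalAInfCat.m_single_zsmul {K : Type u} [CommRing K] (C : UnitalAInfCat.{u, u, u} K)
    {x y : C.Obj} (c : ℤ) (v : C.Hom x y) :
    C.m ((Chain.nil x).snoc (c • v)) = c • C.m ((Chain.nil x).snoc v) := by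
  rw [← Int.cast_smul_eq_zsmul K, ← Int.cast_smul_eq_zsmul K]
  exact C.m_multilinear.map_smul (Chain.nil x) c v (Chain.nil y)

namespace MappingSimplex

open Simplex Simplicial DoldKanCochains

section vertices

variable {m n : ℕ}

/-- The list of values of `θ : [m] → [n]`, seen as vertices of `[n + 1]`. -/
def vertices (θ : ⦋m⦌ ⟶ ⦋n⦌) : List (Fin (n + 2)) :=
  List.ofFn fun j : Fin (m + 1) => (θ.toOrderHom j).castSucc

lemma length_vertices (θ : ⦋m⦌ ⟶ ⦋n⦌) : (vertices θ).length = m + 1 := List.length_ofFn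

lemma getElem_vertices (θ : ⦋m⦌ ⟶ ⦋n⦌) (j : ℕ) (hj : j < (vertices θ).length) :
    (vertices θ)[j] = (θ.toOrderHom ⟨j, hj.trans_eq (length_vertices θ)⟩).castSucc :=
  List.getElem_ofFn hj

lemma vertices_inj {m' : ℕ} {θ : ⦋m⦌ ⟶ ⦋n⦌} {θ' : ⦋m'⦌ ⟶ ⦋n⦌} (h : vertices θ = vertices θ') :
    (⟨m, θ⟩ : Σ m : ℕ, (⦋m⦌ ⟶ ⦋n⦌)) = ⟨m', θ'⟩ := by
  obtain rfl : m = m' := by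
    have := congrArg List.length h
    rw [length_vertices, length_vertices] at this
    omega
  have h' := List.ofFn_injective h
  congr 1
  ext j : 3
  exact Fin.castSucc_injective _ (congrFun h' j)

lemma last_notMem_vertices (θ : ⦋m⦌ ⟶ ⦋n⦌) : Fin.last (n + 1) ∉ vertices θ := by
  intro h
  obtain ⟨j, hj⟩ := List.mem_ofFn.1 h
  exact (Fin.castSucc_lt_last _).ne hj

lemma pairwise_vertices_append_iff (θ : ⦋m⦌ ⟶ ⦋n⦌) :
    (vertices θ ++ [Fin.last (n + 1)]).Pairwise (· < ·) ↔ Function.Injective θ.toOrderHom := by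
  have h1 : (vertices θ ++ [Fin.last (n + 1)]).Pairwise (· < ·) ↔
      (vertices θ).Pairwise (· < ·) := by
    rw [List.pairwise_append]
    refine ⟨fun h => h.1, fun h => ⟨h, List.pairwise_singleton _ _, fun a ha b hb => ?_⟩⟩
    obtain rfl := List.mem_singleton.1 hb
    obtain ⟨j, rfl⟩ := List.mem_ofFn.1 ha
    exact Fin.castSucc_lt_last _
  rw [h1, vertices, List.pairwise_ofFn]
  simp only [Fin.castSucc_lt_castSucc_iff]
  exact ⟨fun h => StrictMono.injective fun i j hij => h hij,
    fun h i j hij => θ.toOrderHom.monotone.strictMono_of_injective h hij⟩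

lemma exists_vertices_eq {l : List (Fin (n + 2))} (hl : l ≠ []) (h : l.Pairwise (· ≤ ·))
    (h' : Fin.last (n + 1) ∉ l) : ∃ (m : ℕ) (θ : ⦋m⦌ ⟶ ⦋n⦌), vertices θ = l := by
  obtain ⟨m, hm⟩ : ∃ m, l.length = m + 1 :=
    Nat.exists_eq_succ_of_ne_zero fun h => hl (List.length_eq_zero_iff.1 h)
  have hne : ∀ j : Fin (m + 1), l.get (j.cast hm.symm) ≠ Fin.last (n + 1) := fun j hj =>
    h' (hj ▸ List.get_mem _ _)
  refine ⟨m, SimplexCategory.mkHom ⟨fun j => (l.get (j.cast hm.symm)).castPred (hne j),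
    fun i j hij => ?_⟩, ?_⟩
  · refine Fin.castPred_le_castPred_iff.2 ?_
    rcases hij.eq_or_lt with rfl | hij
    · exact le_rfl
    · exact List.pairwise_iff_get.1 h _ _ hij
  · refine List.ext_getElem ?_ fun k h1 h2 => ?_
    · rw [length_vertices, hm]
    · rw [getElem_vertices]
      exact Fin.castSucc_castPred _ (hne _)

lemma eraseIdx_vertices (θ : ⦋m + 1⦌ ⟶ ⦋n⦌) (k : Fin (m + 2)) :
    (vertices θ).eraseIdx k = vertices (SimplexCategory.δ k ≫ θ) := by
  refine List.ext_getElem ?_ fun j h1 h2 => ?_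
  · rw [List.length_eraseIdx_of_lt, length_vertices, length_vertices]
    · rfl
    · rw [length_vertices]; exact k.2
  · have h3 : j < m + 1 := h2.trans_eq (length_vertices _)
    rw [List.getElem_eraseIdx]
    have e : ∀ i : Fin (m + 2), i = k.succAbove ⟨j, h3⟩ → (θ.toOrderHom i).castSucc =
        ((SimplexCategory.δ k ≫ θ).toOrderHom ⟨j, h3⟩).castSucc := fun i hi => by
      subst hi
      rfl
    split_ifs with h
    · rw [getElem_vertices, getElem_vertices]
      exact e _ (Fin.succAbove_of_castSucc_lt k ⟨j, h3⟩ h).symm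
    · rw [getElem_vertices, getElem_vertices]
      exact e _ (Fin.succAbove_of_le_castSucc k ⟨j, h3⟩ (not_lt.1 h)).symm

lemma eraseIdx_vertices_zero (θ : ⦋0⦌ ⟶ ⦋n⦌) : (vertices θ).eraseIdx 0 = [] := by
  rw [← List.length_eq_zero_iff, List.length_eraseIdx_of_lt] <;> simp [length_vertices]

lemma pairwise_vertices (θ : ⦋m⦌ ⟶ ⦋n⦌) : (vertices θ).Pairwise (· ≤ ·) := by
  rw [vertices, List.pairwise_ofFn]
  exact fun i j hij => Fin.castSucc_le_castSucc_iff.2 (θ.toOrderHom.monotone hij.le)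

lemma map_vertices {m' : ℕ} (θ : ⦋m'⦌ ⟶ ⦋m⦌) (α : ⦋m⦌ ⟶ ⦋n⦌) :
    (vertices θ).map (SSet.extendLast α).toOrderHom = vertices (θ ≫ α) := by
  rw [vertices, List.map_ofFn]
  refine congrArg List.ofFn (funext fun j => ?_)
  exact SSet.extendLast_castSucc α _

end vertices

variable {K : Type u} [CommRing K] {C : UnitalAInfCat.{u, u, u} K} {x y : C.Obj} {m n : ℕ}

open Classical in
/-- The family of morphisms with value `(-1)ᵐ g θ` on the list of vertices of `θ : [m] → [n]`, and
zero on all other lists. -/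
def family (g : ∀ m : ℕ, (⦋m⦌ ⟶ ⦋n⦌) → (C.truncMapComplex x y).X m) (l : List (Fin (n + 2))) :
    C.Hom x y :=
  if h : ∃ θ : Σ m : ℕ, (⦋m⦌ ⟶ ⦋n⦌), vertices θ.2 = l then
    (-1 : ℤ) ^ h.choose.1 • C.truncInclusion x y _ (g _ h.choose.2) else 0

lemma family_vertices (g : ∀ m : ℕ, (⦋m⦌ ⟶ ⦋n⦌) → (C.truncMapComplex x y).X m) (θ : ⦋m⦌ ⟶ ⦋n⦌) :
    family g (vertices θ) = (-1 : ℤ) ^ m • C.truncInclusion x y m (g m θ) := by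
  have h : ∃ θ' : Σ m : ℕ, (⦋m⦌ ⟶ ⦋n⦌), vertices θ'.2 = vertices θ := ⟨⟨m, θ⟩, rfl⟩
  rw [family, dif_pos h]
  have h' : h.choose = ⟨m, θ⟩ := vertices_inj h.choose_spec
  exact congrArg (fun θ : Σ m : ℕ, (⦋m⦌ ⟶ ⦋n⦌) =>
    (-1 : ℤ) ^ θ.1 • C.truncInclusion x y θ.1 (g θ.1 θ.2)) h'

lemma family_of_forall_ne (g : ∀ m : ℕ, (⦋m⦌ ⟶ ⦋n⦌) → (C.truncMapComplex x y).X m)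
    {l : List (Fin (n + 2))} (h : ∀ (m : ℕ) (θ : ⦋m⦌ ⟶ ⦋n⦌), vertices θ ≠ l) : family g l = 0 :=
  dif_neg fun ⟨θ, hθ⟩ => h θ.1 θ.2 hθ

lemma family_nil (g : ∀ m : ℕ, (⦋m⦌ ⟶ ⦋n⦌) → (C.truncMapComplex x y).X m) : family g [] = 0 :=
  family_of_forall_ne _ fun m θ h => by
    have := congrArg List.length h
    rw [length_vertices] at this
    simp at this

lemma isAdmissible_family (g : cochains (C.truncMapComplex x y) ⦋n⦌) :
    IsAdmissible (family g.1) where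
  map_nil := family_nil _
  eq_zero l hl := by
    by_cases h : ∃ (m : ℕ) (θ : ⦋m⦌ ⟶ ⦋n⦌), vertices θ = l
    · obtain ⟨m, θ, rfl⟩ := h
      rw [family_vertices, g.2.1 m θ fun h => hl ((pairwise_vertices_append_iff θ).2 h),
        map_zero, smul_zero]
    · exact family_of_forall_ne _ fun m θ hθ => h ⟨m, θ, hθ⟩
  mem_deg l := by
    by_cases h : ∃ (m : ℕ) (θ : ⦋m⦌ ⟶ ⦋n⦌), vertices θ = l
    · obtain ⟨m, θ, rfl⟩ := h
      rw [family_vertices, length_vertices]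
      have := (C.deg x y (-(m : ℤ))).toAddSubgroup.zsmul_mem (C.truncInclusion_mem x y m (g.1 m θ))
        ((-1) ^ m)
      rwa [show (1 : ℤ) - (m + 1 : ℕ) = -(m : ℤ) by push_cast; ring]
    · rw [family_of_forall_ne _ fun m θ hθ => h ⟨m, θ, hθ⟩]
      exact Submodule.zero_mem _
  rel l hl hl' := by
    by_cases h : l = []
    · subst h
      rw [family_nil, List.length_nil, Finset.range_zero, Finset.sum_empty, add_zero]
      exact C.m_multilinear.map_zero (Chain.nil x) (Chain.nil y)
    obtain ⟨m, θ, rfl⟩ := exists_vertices_eq h hl hl'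
    rw [family_vertices, length_vertices, C.m_single_zsmul]
    cases m with
    | zero =>
      rw [C.m_truncInclusion_zero, Finset.sum_range_one, eraseIdx_vertices_zero, family_nil,
        smul_zero, add_zero]
    | succ m =>
      rw [C.m_truncInclusion, g.2.2, Finset.sum_range, map_sum, Finset.smul_sum,
        ← Finset.sum_add_distrib]
      refine Finset.sum_eq_zero fun k _ => ?_
      rw [eraseIdx_vertices, family_vertices, map_zsmul, pow_succ, mul_neg_one, neg_smul,
        smul_comm, neg_add_cancel]

/-- The simplex of the right mapping space given by a normalized chain map. -/
def ofCochain (g : cochains (C.truncMapComplex x y) ⦋n⦌) :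
    (aInfNerve.homR C x y).obj (op (.mk n)) :=
  simplex (family g.1) (isAdmissible_family g)

lemma map_ofCochain (α : ⦋m⦌ ⟶ ⦋n⦌) (g : cochains (C.truncMapComplex x y) ⦋n⦌) :
    (aInfNerve.homR C x y).map α.op (ofCochain g) = ofCochain (cochainsMap _ α g) := by
  refine map_simplex _ α _ fun l => ?_
  by_cases h : (l ++ [Fin.last (m + 1)]).Pairwise (· < ·)
  · by_cases hl : l = []
    · subst hl
      exact (isAdmissible_family _).map_nil.trans (isAdmissible_family g).map_nil.symm
    · obtain ⟨h1, -, h2⟩ := List.pairwise_append.1 h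
      obtain ⟨k, θ, rfl⟩ := exists_vertices_eq hl (h1.imp le_of_lt) fun h' =>
        (h2 _ h' _ (List.mem_singleton.2 rfl)).ne rfl
      rw [map_vertices, family_vertices, family_vertices]
      rfl
  · rw [(isAdmissible_family _).eq_zero l h, (isAdmissible_family g).eq_zero]
    intro h'
    refine h (List.Pairwise.of_map (S := (· < ·)) (SSet.extendLast α).toOrderHom
      (fun a b hab => (SSet.extendLast α).toOrderHom.monotone.reflect_lt hab) ?_)
    rwa [List.map_append, List.map_singleton, SSet.extendLast_last]

end MappingSimplex

/-! ### Multilinear families on the simplex categories -/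

namespace Simplex

variable {K : Type u} [CommRing K] {N : ℕ}

/-- The morphisms between two vertices form a module of rank at most one, hence the values of a
multilinear family on two chains through the same vertices are proportional. -/
lemma coef_smul_eq {M : Fin (N + 1) → Fin (N + 1) → Type*} [∀ i k, AddCommGroup (M i k)]
    [∀ i k, Module K (M i k)]
    {φ : ∀ {i k : Fin (N + 1)}, Chain (quiver K N).Hom i k → M i k}
    (hφ : IsMultilinear (quiver K N) (N := M) φ) {i k l : Fin (N + 1)}
    (p q : Chain (quiver K N).Hom i k) (h : sources p = sources q)
    (r : Chain (quiver K N).Hom k l) :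
    coef q • φ (p.append r) = coef p • φ (q.append r) := by
  induction p with
  | nil =>
    cases q with
    | nil => rfl
    | snoc q b => simp [sources] at h
  | @snoc j k p a ih =>
    cases q with
    | nil => simp [sources] at h
    | @snoc j' _ q b =>
      obtain ⟨h1, h2⟩ := List.append_inj' h rfl
      obtain rfl : j = j' := List.singleton_inj.1 h2
      have e1 := hφ.map_smul p b.1 a r
      have e2 := hφ.map_smul p a.1 b r
      have e3 : b.1 • a = a.1 • b := Subtype.ext (mul_comm b.1 a.1)
      have e4 := ih q h1 (((Chain.nil j).snoc b).append r)
      rw [← Chain.append_assoc, ← Chain.append_assoc] at e4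
      rw [e3] at e1
      calc coef (q.snoc b) • φ ((p.snoc a).append r)
          = coef q • b.1 • φ ((p.snoc a).append r) := mul_smul _ _ _
        _ = coef q • a.1 • φ ((p.snoc b).append r) := congrArg (coef q • ·) (e1.symm.trans e2)
        _ = a.1 • coef q • φ ((p.snoc b).append r) := smul_comm _ _ _
        _ = a.1 • coef p • φ ((q.snoc b).append r) := congrArg (a.1 • ·) e4
        _ = coef (p.snoc a) • φ ((q.snoc b).append r) := by
          rw [smul_smul, mul_comm]
          rfl

lemma eq_coef_smul {M : Fin (N + 1) → Fin (N + 1) → Type*} [∀ i k, AddCommGroup (M i k)]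
    [∀ i k, Module K (M i k)]
    {φ : ∀ {i k : Fin (N + 1)}, Chain (quiver K N).Hom i k → M i k}
    (hφ : IsMultilinear (quiver K N) (N := M) φ) {i k : Fin (N + 1)}
    (p q : Chain (quiver K N).Hom i k) (h : sources p = sources q) (hq : coef q = 1) :
    φ p = coef p • φ q := by
  have := coef_smul_eq hφ p q h (Chain.nil k)
  rwa [hq, one_smul] at this

/-- The generator of the morphisms from `i` to `k`. -/
def generator {i k : Fin (N + 1)} (h : i ≤ k) : (quiver K N).HomogHom i k :=
  ⟨0, ⟨⟨1, fun h' => absurd h h'⟩, mem_deg_zero _⟩⟩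

lemma exists_chain_of_pairwise (i : Fin (N + 1)) (l : List (Fin (N + 1))) (k : Fin (N + 1))
    (h : (i :: l ++ [k]).Pairwise (· ≤ ·)) :
    ∃ q : Chain (quiver K N).HomogHom i k,
      IsRegular q ∧ coef (under q) = 1 ∧ sources (under q) = i :: l := by
  induction l using List.reverseRecOn generalizing k with
  | nil =>
    have hik : i ≤ k := by simpa using h
    exact ⟨(Chain.nil i).snoc (generator hik), ⟨trivial, rfl, hik⟩, one_mul _, rfl⟩
  | append_singleton l j ih =>
    obtain ⟨h1, -, h2⟩ := List.pairwise_append.1 h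
    obtain ⟨q, hq1, hq2, hq3⟩ := ih j (by simpa using h1)
    have hjk : j ≤ k := h2 j (by simp) k (List.mem_singleton.2 rfl)
    refine ⟨q.snoc (generator hjk), ⟨hq1, rfl, hjk⟩, (mul_one _).trans hq2, ?_⟩
    exact congrArg (· ++ [j]) hq3

/-- A chain of morphisms, seen as a chain of homogeneous morphisms. -/
def toHomog {i : Fin (N + 1)} : {k : Fin (N + 1)} → Chain (quiver K N).Hom i k →
    Chain (quiver K N).HomogHom i k
  | _, .nil _ => .nil _
  | _, .snoc p a => .snoc (toHomog p) ⟨0, ⟨a, mem_deg_zero a⟩⟩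

lemma under_toHomog {i k : Fin (N + 1)} (p : Chain (quiver K N).Hom i k) :
    under (toHomog p) = p := by
  induction p with
  | nil => rfl
  | snoc p a ih => exact congrArg (Chain.snoc · a) ih

/-- A chain through weakly but not strictly increasing vertices contains an endomorphism. -/
lemma exists_loop {i k : Fin (N + 1)} (q : Chain (quiver K N).HomogHom i k) (hq : IsRegular q)
    (h : ¬ (sources (under q) ++ [k]).Pairwise (· < ·)) :
    ∃ (j : Fin (N + 1)) (p : Chain (quiver K N).Hom i j) (a : (quiver K N).Hom j j)
      (r : Chain (quiver K N).Hom j k), (p.snoc a).append r = under q := by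
  induction q with
  | nil => simp [under, Chain.map, sources] at h
  | @snoc j k q a ih =>
    by_cases hjk : j = k
    · subst hjk
      exact ⟨j, under q, a.2.1, Chain.nil _, rfl⟩
    · have hlt := lt_of_le_of_ne hq.2.2 hjk
      obtain ⟨j', p, b, r, hr⟩ := ih hq.1 fun h' => h (by
        refine List.pairwise_append.2 ⟨h', List.pairwise_singleton _ _, fun b hb c hc => ?_⟩
        obtain rfl := List.mem_singleton.1 hc
        rcases List.mem_append.1 hb with hb | hb
        · exact ((List.pairwise_append.1 hq.1.pairwise).2.2 b hb j
            (List.mem_singleton.2 rfl)).trans_lt hlt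
        · exact (List.mem_singleton.1 hb).trans_lt hlt)
      exact ⟨j', p, b, r.snoc a.2.1, congrArg (Chain.snoc · a.2.1) hr⟩

/-- The conditions on the components of a unital `A_∞`-functor other than the degrees and the
functor equations. -/
structure IsUnitalFamily {C : UnitalAInfCat.{u, u, u} K} (o : Fin (N + 1) → C.Obj)
    (φ : ∀ {i k : Fin (N + 1)}, Chain (quiver K N).Hom i k → C.Hom (o i) (o k)) : Prop where
  map_nil : ∀ i : Fin (N + 1), φ (Chain.nil i) = 0
  multilinear : IsMultilinear (quiver K N) (N := fun i k => C.Hom (o i) (o k)) φ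
  map_one : ∀ i : Fin (N + 1), φ ((Chain.nil i).snoc ((cat K N).one i)) = C.one (o i)
  map_one_eq_zero : ∀ {i j k : Fin (N + 1)} (p : Chain (quiver K N).Hom i j)
    (q : Chain (quiver K N).Hom j k), 2 ≤ p.length + 1 + q.length →
      φ ((p.snoc ((cat K N).one j)).append q) = 0

lemma smul_one_eq {i : Fin (N + 1)} (a : (quiver K N).Hom i i) : a = a.1 • (cat K N).one i :=
  Subtype.ext (mul_one _).symm

lemma IsUnitalFamily.append_eq_zero {C : UnitalAInfCat.{u, u, u} K} {o : Fin (N + 1) → C.Obj}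
    {φ : ∀ {i k : Fin (N + 1)}, Chain (quiver K N).Hom i k → C.Hom (o i) (o k)}
    (hφ : IsUnitalFamily o φ) {i j k : Fin (N + 1)} (p : Chain (quiver K N).Hom i j)
    (a : (quiver K N).Hom j j) (q : Chain (quiver K N).Hom j k)
    (h : 2 ≤ p.length + 1 + q.length) : φ ((p.snoc a).append q) = 0 := by
  rw [smul_one_eq a]
  exact (hφ.multilinear.map_smul p a.1 _ q).trans
    ((congrArg (a.1 • ·) (hφ.map_one_eq_zero p q h)).trans (smul_zero _))

/-- Unital families are determined by their values on chains through strictly increasing vertices: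
all other chains contain zero or a multiple of an identity. -/
lemma IsUnitalFamily.ext {C : UnitalAInfCat.{u, u, u} K} {o : Fin (N + 1) → C.Obj}
    {φ ψ : ∀ {i k : Fin (N + 1)}, Chain (quiver K N).Hom i k → C.Hom (o i) (o k)}
    (hφ : IsUnitalFamily o φ) (hψ : IsUnitalFamily o ψ)
    (h : ∀ {i k : Fin (N + 1)} (q : Chain (quiver K N).HomogHom i k), IsRegular q →
      (sources (under q) ++ [k]).Pairwise (· < ·) → 1 ≤ q.length → φ (under q) = ψ (under q))
    {i k : Fin (N + 1)} (p : Chain (quiver K N).Hom i k) : φ p = ψ p := by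
  rcases hasZero_or_isRegular (toHomog p) with hp | hp
  · rw [under_toHomog] at hp
    rw [hφ.multilinear.eq_zero_of_hasZero p hp, hψ.multilinear.eq_zero_of_hasZero p hp]
  · by_cases hlt : (sources (under (toHomog p)) ++ [k]).Pairwise (· < ·)
    · cases p with
      | nil => rw [hφ.map_nil, hψ.map_nil]
      | snoc p a =>
        have := h _ hp hlt (by simp [toHomog, Chain.length])
        rwa [under_toHomog] at this
    · obtain ⟨j, q, a, r, hr⟩ := exists_loop _ hp hlt
      rw [under_toHomog] at hr
      subst hr
      by_cases hlen : 2 ≤ q.length + 1 + r.length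
      · rw [hφ.append_eq_zero q a r hlen, hψ.append_eq_zero q a r hlen]
      · cases q with
        | snoc q b => simp only [Chain.length] at hlen; omega
        | nil =>
          cases r with
          | snoc r b => simp only [Chain.length] at hlen; omega
          | nil =>
            rw [smul_one_eq a]
            refine (hφ.multilinear.map_smul (Chain.nil i) a.1 _ (Chain.nil i)).trans
              (Eq.trans ?_ (hψ.multilinear.map_smul (Chain.nil i) a.1 _ (Chain.nil i)).symm)
            exact congrArg (a.1 • ·) ((hφ.map_one i).trans (hψ.map_one i).symm)

/-- A chain that does not reach the last vertex passes through the same vertices as a chain of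
generators in the image of the last face map. -/
lemma exists_mapChain_δ_last {i k : Fin (N + 2)} (q : Chain (quiver K (N + 1)).HomogHom i k)
    (hq : IsRegular q) {k' : Fin (N + 1)} (hk : k = Fin.succAbove (Fin.last (N + 1)) k') :
    ∃ (i' : Fin (N + 1)) (p : Chain (quiver K N).Hom i' k'),
      i = Fin.succAbove (Fin.last (N + 1)) i' ∧ coef p = 1 ∧
      (sources p).map (Fin.succAbove (Fin.last (N + 1))) = sources (under q) := by
  induction q generalizing k' with
  | nil => exact ⟨k', Chain.nil _, hk, rfl, rfl⟩
  | @snoc j k q a ih =>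
    have hj : j ≠ Fin.last (N + 1) := by
      rintro rfl
      have h := Fin.last_le_iff.1 hq.2.2
      rw [hk] at h
      exact Fin.succAbove_ne _ _ h
    obtain ⟨j', hj'⟩ := Fin.exists_succAbove_eq hj
    obtain ⟨i', p, h1, h2, h3⟩ := ih hq.1 hj'.symm
    have hjk : j' ≤ k' := by
      have h := hq.2.2
      rw [hk, ← hj'] at h
      exact (Fin.strictMono_succAbove _).le_iff_le.1 h
    refine ⟨i', p.snoc (generator hjk).2.1, h1, (mul_one _).trans h2, ?_⟩
    rw [sources, List.map_append, h3, List.map_singleton, hj']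
    rfl

end Simplex

/-! ### All simplices of the right mapping space are given by admissible families -/

namespace MappingSimplex

open Simplex

variable {K : Type u} [CommRing K] {C : UnitalAInfCat.{u, u, u} K} {x y : C.Obj} {n : ℕ}

/-- The morphism from `x` to `y` given by a morphism between the objects `vertexObj C x y b` and
`vertexObj C x y c`, with value zero unless `b` is false and `c` is true. -/
def crossPart : (b c : Bool) → C.Hom (vertexObj C x y b) (vertexObj C x y c) → C.Hom x y
  | false, true, v => v
  | _, _, _ => 0

lemma component_crossPart {b c : Bool} (hb : b = false) (hc : c = true) (r : K)
    (v : C.Hom (vertexObj C x y b) (vertexObj C x y c)) :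
    component C x y b c r (crossPart b c v) = v := by
  subst hb hc
  rfl

lemma mem_of_component_mem {b c : Bool} (hb : b = false) (hc : c = true) {r : K} {v : C.Hom x y}
    {d : ℤ} (h : component C x y b c r v ∈ C.deg (vertexObj C x y b) (vertexObj C x y c) d) :
    v ∈ C.deg x y d := by
  subst hb hc
  exact h

lemma eq_zero_of_component_eq_zero {b c : Bool} (hb : b = false) (hc : c = true) {r : K}
    {v : C.Hom x y} (h : component C x y b c r v = 0) : v = 0 := by
  subst hb hc
  exact h

section

variable (φ : ∀ {i k : Fin (n + 2)}, Chain (quiver K (n + 1)).Hom i k →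
  C.Hom (vertexObj C x y (isLast i)) (vertexObj C x y (isLast k)))

open Classical in
/-- The values of `φ` on the chains of generators through strictly increasing vertices that end in
`n + 1`. -/
def values (l : List (Fin (n + 2))) : C.Hom x y :=
  if h : (l ++ [Fin.last (n + 1)]).Pairwise (· < ·) ∧
      ∃ q : Σ i : Fin (n + 2), Chain (quiver K (n + 1)).HomogHom i (Fin.last (n + 1)),
        1 ≤ q.2.length ∧ coef (under q.2) = 1 ∧ sources (under q.2) = l then
    crossPart _ _ (φ (under h.2.choose.2))
  else 0

variable {φ}

lemma values_sources (hφ : IsUnitalFamily (N := n + 1) (fun i => vertexObj C x y (isLast i)) φ)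
    {i : Fin (n + 2)} (q : Chain (quiver K (n + 1)).HomogHom i (Fin.last (n + 1)))
    (hlen : 1 ≤ q.length) (hq : coef (under q) = 1)
    (hlt : (sources (under q) ++ [Fin.last (n + 1)]).Pairwise (· < ·)) :
    values φ (sources (under q)) = crossPart _ _ (φ (under q)) := by
  have h : ∃ q' : Σ i : Fin (n + 2), Chain (quiver K (n + 1)).HomogHom i (Fin.last (n + 1)),
      1 ≤ q'.2.length ∧ coef (under q'.2) = 1 ∧ sources (under q'.2) = sources (under q) :=
    ⟨⟨i, q⟩, hlen, hq, rfl⟩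
  rw [values, dif_pos ⟨hlt, h⟩]
  have key : ∀ q' : Σ i : Fin (n + 2), Chain (quiver K (n + 1)).HomogHom i (Fin.last (n + 1)),
      (1 ≤ q'.2.length ∧ coef (under q'.2) = 1 ∧ sources (under q'.2) = sources (under q)) →
      crossPart _ _ (φ (under q'.2)) = crossPart _ _ (φ (under q)) := by
    rintro ⟨i', q'⟩ ⟨h1, h2, h3⟩
    obtain ⟨l, hl⟩ := sources_eq_cons (under q) (hlen.trans_eq (length_under q).symm)
    obtain ⟨l', hl'⟩ := sources_eq_cons (under q') (h1.trans_eq (length_under q').symm)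
    obtain rfl : i' = i := (List.cons.inj (hl'.symm.trans (h3.trans hl))).1
    have := eq_coef_smul hφ.multilinear (under q') (under q) h3 hq
    rw [this, h2, one_smul]
  exact key _ h.choose_spec

lemma isNormalized_values : IsNormalized (values φ) where
  map_nil := by
    refine dif_neg ?_
    rintro ⟨-, q, h1, -, h2⟩
    have := length_sources_under q.2
    rw [h2, List.length_nil] at this
    omega
  eq_zero l hl := dif_neg fun h => hl h.1

lemma isUnitalFamily_functorMap {f : List (Fin (n + 2)) → C.Hom x y} (hf : IsNormalized f) :
    IsUnitalFamily (N := n + 1) (fun i => vertexObj C x y (isLast i)) (functorMap C x y f) where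
  map_nil := functorMap_nil f
  multilinear := functorMap_multilinear f
  map_one := functorMap_one f
  map_one_eq_zero p q h := functorMap_append_eq_zero hf p _ q h

lemma isLast_eq_false_of_pairwise {i k : Fin (n + 2)}
    {q : Chain (quiver K (n + 1)).HomogHom i k}
    (hlt : (sources (under q) ++ [k]).Pairwise (· < ·)) (hlen : 1 ≤ q.length) :
    isLast i = false := by
  obtain ⟨l, hl⟩ := sources_eq_cons (under q) (hlen.trans_eq (length_under q).symm)
  rw [hl] at hlt
  refine decide_eq_false fun h => ?_
  have := (List.pairwise_append.1 hlt).2.2 i List.mem_cons_self k (List.mem_singleton.2 rfl)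
  rw [h] at this
  exact absurd (Fin.le_last k) (not_le.2 this)

/-- A unital family which on `{0, …, n}` is that of the degenerate simplex on `x` is determined by
its values on the chains of generators through strictly increasing vertices that end in `n + 1`. -/
lemma eq_functorMap_values
    (hφ : IsUnitalFamily (N := n + 1) (fun i => vertexObj C x y (isLast i)) φ)
    (hx : ∀ {i k : Fin (n + 1)} (p : Chain (quiver K n).Hom i k),
      HEq (φ ((functor (SimplexCategory.δ (Fin.last (n + 1))).toOrderHom).mapChain p))
        ((if p.length = 1 then coef p else 0) • C.one x))
    {i k : Fin (n + 2)} (p : Chain (quiver K (n + 1)).Hom i k) :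
    φ p = functorMap C x y (values φ) p := by
  refine hφ.ext (isUnitalFamily_functorMap isNormalized_values) (fun {i k} q hq hlt hlen => ?_) p
  by_cases hk : k = Fin.last (n + 1)
  · subst hk
    obtain ⟨l, hl⟩ := sources_eq_cons (under q) (hlen.trans_eq (length_under q).symm)
    have hle := hq.pairwise
    rw [hl] at hle
    obtain ⟨q', h1, h2, h3⟩ := exists_chain_of_pairwise (K := K) i l _ hle
    have h4 : sources (under q) = sources (under q') := hl.trans h3.symm
    have hlen' : 1 ≤ q'.length := by
      rwa [← length_sources_under, ← h4, length_sources_under]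
    rw [h4] at hlt
    rw [eq_coef_smul hφ.multilinear (under q) (under q') h4 h2,
      eq_coef_smul (functorMap_multilinear (values φ)) (under q) (under q') h4 h2]
    congr 1
    rw [functorMap, h2, one_smul, values_sources hφ q' hlen' h2 hlt]
    exact (component_crossPart (isLast_eq_false_of_pairwise hlt hlen') isLast_last _ _).symm
  · obtain ⟨k', hk'⟩ := Fin.exists_succAbove_eq hk
    obtain ⟨i', p', h1, h2, h3⟩ := exists_mapChain_δ_last q hq hk'.symm
    subst h1 hk'
    let P := (functor (K := K) (SimplexCategory.δ (Fin.last (n + 1))).toOrderHom).mapChain p'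
    have h4 : sources (under q) = sources P := h3.symm.trans
      (sources_mapChain (SimplexCategory.δ (Fin.last (n + 1))).toOrderHom p').symm
    have h5 : coef P = 1 := (coef_mapChain _ p').trans h2
    have h6 : ∀ j : Fin (n + 1), isLast (Fin.succAbove (Fin.last (n + 1)) j) = false := fun j =>
      (congrArg isLast (Fin.succAbove_last_apply j)).trans (isLast_castSucc j)
    have h7 : p'.length = (under q).length := by
      rw [← length_sources, ← length_sources, ← h3, List.length_map]
    have h8 : φ P = component C x y _ _ (if p'.length = 1 then coef p' else 0)
        (values φ (sources (under q))) :=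
      eq_of_heq ((hx p').trans (component_heq (h6 i').symm (h6 k').symm _ _))
    refine (eq_coef_smul hφ.multilinear (under q) P h4 h5).trans
      ((congrArg (coef (under q) • ·) h8).trans ((component_smul _ _ _ _ _).symm.trans ?_))
    rw [functorMap, h2, h7]
    congr 1
    split_ifs <;> simp

end

/-- The normalized families that give rise to an `A_∞`-functor are admissible. -/
lemma isAdmissible_of_functorMap {f : List (Fin (n + 2)) → C.Hom x y} (hf : IsNormalized f)
    (hdeg : ∀ {i k : Fin (n + 2)} (p : Chain (quiver K (n + 1)).HomogHom i k),
      functorMap C x y f (under p) ∈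
        C.deg (vertexObj C x y (isLast i)) (vertexObj C x y (isLast k)) (sdeg p + 1))
    (hrel : ∀ {i k : Fin (n + 2)} (p : Chain (quiver K (n + 1)).HomogHom i k),
      ((Chain.blocks (H' := C.Hom) (o := fun i => vertexObj C x y (isLast i))
        (functorMap C x y f) (under p)).map fun c => C.m c).sum =
      barSum (G := quiver K (n + 1))
        (N := fun i k => C.Hom (vertexObj C x y (isLast i)) (vertexObj C x y (isLast k)))
        ops (functorMap C x y f) p) :
    IsAdmissible f where
  toIsNormalized := hf
  mem_deg l := by
    by_cases h : l ≠ [] ∧ (l ++ [Fin.last (n + 1)]).Pairwise (· < ·)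
    · obtain ⟨hl, hlt⟩ := h
      obtain ⟨i, l, rfl⟩ := List.exists_cons_of_ne_nil hl
      obtain ⟨q, h1, h2, h3⟩ := exists_chain_of_pairwise (K := K) i l _ (hlt.imp le_of_lt)
      have h4 := length_sources_under q
      have h5 := h1.sdeg_eq
      rw [← h3] at hlt
      have h6 := mem_of_component_mem (isLast_eq_false_of_pairwise hlt
        (by rw [← h4, h3, List.length_cons]; omega)) isLast_last (hdeg q)
      rw [h2, one_smul, h5, ← h4, h3, neg_add_eq_sub] at h6
      exact h6
    · have h0 : f l = 0 := by
        by_cases hl : l = []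
        · rw [hl, hf.map_nil]
        · exact hf.eq_zero l fun h' => h ⟨hl, h'⟩
      rw [h0]
      exact Submodule.zero_mem _
  rel l hl hl' := by
    cases l with
    | nil =>
      rw [hf.map_nil, List.length_nil, Finset.range_zero, Finset.sum_empty, add_zero]
      exact C.m_multilinear.map_zero (Chain.nil x) (Chain.nil y)
    | cons i l =>
      obtain ⟨q, h1, h2, h3⟩ := exists_chain_of_pairwise (K := K) i l (Fin.last (n + 1)) (by
        refine List.pairwise_append.2 ⟨hl, List.pairwise_singleton _ _, fun a _ b hb => ?_⟩
        rw [List.mem_singleton.1 hb]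
        exact Fin.le_last a)
      cases q with
      | nil => simp [under, Chain.map, sources] at h3
      | @snoc j _ q a =>
        have hj : isLast j = false := decide_eq_false fun h => hl' (by
          rw [← h3]
          exact List.mem_append_right _ (List.mem_singleton.2 h.symm))
        have h4 := functorMap_rel_last hf q a h1 hj
        rw [hrel, sub_self, h2, h3, one_smul, one_smul] at h4
        exact eq_zero_of_component_eq_zero (isLast_source h1.1 hj) isLast_last h4.symm

theorem exists_simplex_eq (σ : (aInfNerve.homR C x y).obj (op (.mk n))) :
    ∃ (f : List (Fin (n + 2)) → C.Hom x y) (hf : IsAdmissible f), simplex f hf = σ := by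
  have hobj : ∀ i : Fin (n + 2), (aInfNerve.toFunctor σ).obj i = vertexObj C x y (isLast i) := by
    intro i
    induction i using Fin.lastCases with
    | last => rw [isLast_last]; exact aInfNerve.toFunctor_obj_last σ
    | cast i => rw [isLast_castSucc]; exact aInfNerve.toFunctor_obj_castSucc σ i
  obtain ⟨⟨o, φ, h1, h2, h3, h4, h5, h6⟩, hy, hx⟩ := σ
  obtain rfl : o = fun i => vertexObj C x y (isLast i) := funext hobj
  have hφ : IsUnitalFamily (N := n + 1) (fun i => vertexObj C x y (isLast i)) φ :=
    ⟨h1, h2, h5, h6⟩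
  have hx' : ∀ {i k : Fin (n + 1)} (p : Chain (quiver K n).Hom i k),
      HEq (φ ((functor (SimplexCategory.δ (Fin.last (n + 1))).toOrderHom).mapChain p))
        ((if p.length = 1 then coef p else 0) • C.one x) := by
    intro i k p
    have h : ∀ {F G : AInfFunctor (cat K n) C}, F = G → HEq (F.map p) (G.map p) := by
      rintro F _ rfl
      rfl
    have h' : ∀ β : Fin (n + 1) →o Fin 1, (C.point x).onChain ((functor β).mapChain p) =
        (if p.length = 1 then coef p else 0) • C.one x := fun β => by
      rw [point_onChain, (functor (K := K) β).length_mapChain p, coef_mapChain]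
    exact (h hx).trans (heq_of_eq (h' _))
  obtain ⟨f, hf, hφ'⟩ : ∃ f : List (Fin (n + 2)) → C.Hom x y,
      IsNormalized f ∧ @φ = @functorMap K _ C x y n f := by
    refine ⟨values φ, isNormalized_values, ?_⟩
    funext i k p
    exact eq_functorMap_values hφ hx' p
  subst hφ'
  exact ⟨f, isAdmissible_of_functorMap hf h3 h4, Subtype.ext rfl⟩

end MappingSimplex

/-! ### The isomorphism -/

namespace MappingSimplex

open Simplex DoldKanCochains Simplicial

variable {K : Type u} [CommRing K] {C : UnitalAInfCat.{u, u, u} K} {x y : C.Obj} {m n : ℕ}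

lemma family_add_smul (g h : ∀ m : ℕ, (⦋m⦌ ⟶ ⦋n⦌) → (C.truncMapComplex x y).X m) (c : K)
    (l : List (Fin (n + 2))) : family (g + c • h) l = family g l + c • family h l := by
  by_cases hl : ∃ (m : ℕ) (θ : ⦋m⦌ ⟶ ⦋n⦌), vertices θ = l
  · obtain ⟨m, θ, rfl⟩ := hl
    rw [family_vertices, family_vertices, family_vertices, Pi.add_apply, Pi.add_apply,
      Pi.smul_apply, Pi.smul_apply, map_add, map_smul, smul_add, smul_comm c]
  · have hl' : ∀ (m : ℕ) (θ : ⦋m⦌ ⟶ ⦋n⦌), vertices θ ≠ l := fun m θ hθ => hl ⟨m, θ, hθ⟩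
    rw [family_of_forall_ne _ hl', family_of_forall_ne _ hl', family_of_forall_ne _ hl', smul_zero,
      add_zero]

lemma component_ofCochain (g : cochains (C.truncMapComplex x y) ⦋n⦌) (i : Fin (n + 1))
    (p : Chain (cat K (n + 1)).Hom i.castSucc (Fin.last (n + 1))) :
    aInfNerve.component (ofCochain g) i p = coef p • family g.1 (sources p) :=
  component_simplex _ i p

/-- The value on `θ` is recovered from the component on the chain of generators through `θ`. -/
lemma ofCochain_injective :
    Function.Injective (ofCochain : cochains (C.truncMapComplex x y) ⦋n⦌ → _) := by
  intro g h hgh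
  refine Subtype.ext (funext fun m => funext fun θ => ?_)
  have hv : vertices θ = (θ.toOrderHom 0).castSucc ::
      List.ofFn (fun j : Fin m => (θ.toOrderHom j.succ).castSucc) := List.ofFn_succ
  obtain ⟨q, -, h2, h3⟩ := exists_chain_of_pairwise (K := K) (θ.toOrderHom 0).castSucc
    (List.ofFn fun j : Fin m => (θ.toOrderHom j.succ).castSucc) (Fin.last (n + 1)) (by
      rw [← hv]
      refine List.pairwise_append.2 ⟨pairwise_vertices θ, List.pairwise_singleton _ _,
        fun a _ b hb => ?_⟩
      rw [List.mem_singleton.1 hb]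
      exact Fin.le_last a)
  have h4 := component_ofCochain g _ (under q)
  have h5 := component_ofCochain h _ (under q)
  rw [h2, h3, ← hv, one_smul, family_vertices] at h4 h5
  rw [hgh] at h4
  refine C.truncInclusion_injective x y m ?_
  have h6 := h4.symm.trans h5
  have h7 := congrArg ((-1 : ℤ) ^ m • ·) h6
  simpa only [smul_smul, ← mul_pow, neg_mul_neg, one_mul, one_pow, one_smul] using h7

lemma ofCochain_surjective :
    Function.Surjective (ofCochain : cochains (C.truncMapComplex x y) ⦋n⦌ → _) := by
  intro σ
  obtain ⟨f, hf, rfl⟩ := exists_simplex_eq σ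
  have hsign : ∀ (m : ℕ) (v : C.Hom x y), (-1 : ℤ) ^ m • (-1 : ℤ) ^ m • v = v := fun m v => by
    rw [smul_smul, ← mul_pow, neg_mul_neg, one_mul, one_pow, one_smul]
  have hex : ∀ (m : ℕ) (θ : ⦋m⦌ ⟶ ⦋n⦌), ∃ a, C.truncInclusion x y m a =
      (-1 : ℤ) ^ m • f (vertices θ) := fun m θ => by
    refine C.exists_truncInclusion_eq x y m _ ?_ ?_
    · have h := hf.mem_deg (vertices θ)
      rw [length_vertices, show (1 : ℤ) - (m + 1 : ℕ) = -(m : ℤ) by push_cast; ring] at h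
      exact (C.deg x y (-(m : ℤ))).toAddSubgroup.zsmul_mem h _
    · rintro rfl
      have h := hf.rel (vertices θ) (pairwise_vertices θ) (last_notMem_vertices θ)
      rw [length_vertices, Finset.sum_range_one, eraseIdx_vertices_zero, hf.map_nil,
        smul_zero, add_zero] at h
      rw [C.m_single_zsmul, h, smul_zero]
  choose g hg using hex
  have hg' : g ∈ cochains (C.truncMapComplex x y) ⦋n⦌ := by
    refine ⟨fun m θ hθ => C.truncInclusion_injective x y m ?_,
      fun m θ => C.truncInclusion_injective x y m ?_⟩
    · rw [hg, hf.eq_zero _ fun h => hθ ((pairwise_vertices_append_iff θ).1 h), smul_zero, map_zero]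
    · have h := hf.rel (vertices θ) (pairwise_vertices θ) (last_notMem_vertices θ)
      rw [length_vertices, Finset.sum_range] at h
      rw [← C.m_truncInclusion, hg, C.m_single_zsmul, eq_neg_of_add_eq_zero_left h, map_sum,
        pow_succ, mul_neg_one, neg_smul_neg, Finset.smul_sum]
      refine Finset.sum_congr rfl fun k _ => ?_
      rw [map_zsmul, hg, eraseIdx_vertices, smul_comm]
  refine ⟨⟨g, hg'⟩, ?_⟩
  have hfam : family g = f := by
    funext l
    by_cases hl : ∃ (m : ℕ) (θ : ⦋m⦌ ⟶ ⦋n⦌), vertices θ = l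
    · obtain ⟨m, θ, rfl⟩ := hl
      rw [family_vertices, hg, hsign]
    · rw [family_of_forall_ne _ fun m θ hθ => hl ⟨m, θ, hθ⟩]
      by_cases hnil : l = []
      · rw [hnil, hf.map_nil]
      · refine (hf.eq_zero l fun h => hl ?_).symm
        obtain ⟨h1, -, h2⟩ := List.pairwise_append.1 h
        exact exists_vertices_eq hnil (h1.imp le_of_lt) fun h' =>
          (h2 _ h' _ (List.mem_singleton.2 rfl)).ne rfl
  subst hfam
  rfl

variable (C x y) in
/-- The right mapping space is isomorphic to the simplicial set of normalized chain maps from the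
standard simplices to the truncated mapping complex. -/
def cochainsIso : cochainsObj (C.truncMapComplex x y) ⋙ forget (ModuleCat.{u} K) ≅
    aInfNerve.homR C x y :=
  NatIso.ofComponents
    (fun Δ => (Equiv.ofBijective (ofCochain (n := Δ.unop.len))
      ⟨ofCochain_injective, ofCochain_surjective⟩).toIso)
    (fun {Δ Δ'} α => by
      ext g
      exact (map_ofCochain (m := Δ'.unop.len) (n := Δ.unop.len) α.unop g).symm)

end MappingSimplex

end

theorem lemma3p3 {K : Type u} [CommRing K] (C : UnitalAInfCat.{u, u, u} K) (x y : C.Obj) :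
    ∃ e : aInfNerve.homR C x y ≅
        doldKan (C.truncMapComplex x y) ⋙ CategoryTheory.forget (ModuleCat.{u} K),
      ∀ (n : ℕ) (σ τ : (aInfNerve.homR C x y).obj (op (.mk n))) (c : K),
        ∃ ρ : (aInfNerve.homR C x y).obj (op (.mk n)),
          (∀ (i : Fin (n + 1))
              (p : Chain (Simplex.cat K (n + 1)).Hom i.castSucc (Fin.last (n + 1))),
            aInfNerve.component ρ i p =
              aInfNerve.component σ i p + c • aInfNerve.component τ i p) ∧
          (e.hom.app (op (.mk n)) ρ : (doldKan (C.truncMapComplex x y)).obj (op (.mk n))) =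
            (e.hom.app (op (.mk n)) σ : (doldKan (C.truncMapComplex x y)).obj (op (.mk n))) +
              c • (e.hom.app (op (.mk n)) τ : (doldKan (C.truncMapComplex x y)).obj (op (.mk n))) := by
  have := DoldKanCochains.isIso_comparison (C.truncMapComplex x y)
  refine ⟨(MappingSimplex.cochainsIso C x y).symm ≪≫ Functor.isoWhiskerRight
    (asIso (DoldKanCochains.comparison (C.truncMapComplex x y))).symm (forget _),
    fun n σ τ c => ?_⟩
  obtain ⟨g, rfl⟩ := MappingSimplex.ofCochain_surjective σ
  obtain ⟨h, rfl⟩ := MappingSimplex.ofCochain_surjective τ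
  have key : ∀ g : DoldKanCochains.cochains (C.truncMapComplex x y) (.mk n),
      (MappingSimplex.cochainsIso C x y).inv.app (op (.mk n)) (MappingSimplex.ofCochain g) = g :=
    fun g => (Equiv.ofBijective _ _).symm_apply_apply g
  have key' : ∀ g : DoldKanCochains.cochains (C.truncMapComplex x y) (.mk n),
      ((MappingSimplex.cochainsIso C x y).symm ≪≫ Functor.isoWhiskerRight
        (asIso (DoldKanCochains.comparison (C.truncMapComplex x y))).symm
        (forget _)).hom.app (op (.mk n)) (MappingSimplex.ofCochain g) =
      (inv (DoldKanCochains.comparison (C.truncMapComplex x y))).app (op (.mk n)) g :=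
    fun g => congrArg ((inv (DoldKanCochains.comparison (C.truncMapComplex x y))).app
      (op (.mk n))) (key g)
  refine ⟨MappingSimplex.ofCochain (g + c • h), fun i p => ?_, ?_⟩
  · rw [MappingSimplex.component_ofCochain, MappingSimplex.component_ofCochain,
      MappingSimplex.component_ofCochain, smul_comm c, ← smul_add]
    congr 1
    exact MappingSimplex.family_add_smul g.1 h.1 c _
  · let F : DoldKanCochains.cochains (C.truncMapComplex x y) (.mk n) →ₗ[K]
        (doldKan (C.truncMapComplex x y)).obj (op (.mk n)) :=
      ((inv (DoldKanCochains.comparison (C.truncMapComplex x y))).app (op (.mk n))).hom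
    have hF : F (g + c • h) = F g + c • F h := by rw [_root_.map_add, _root_.map_smul]
    exact (key' _).trans (hF.trans
      (congrArg₂ (· + ·) (key' g).symm (congrArg (c • ·) (key' h).symm)))
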